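/- Let $\mathbb K$ be a field and let $\mathcal S$ be a numerical semigroup with minimal generating set $A=\{a_1,a_2,a_3\}$, where $a_1,a_2,a_3$ are pairwise distinct (so $\gcd(a_1,a_2,a_3)=1$ and no proper subset of $A$ generates $\mathcal S$). Let $I_A\subseteq\mathbb K[x_1,x_2,x_3]$ be the toric ideal of $A$, generated by all binomials $\mathbf x^{\mathbf u}-\mathbf x^{\mathbf v}$ with $\sum_i u_ia_i=\sum_i v_ia_i$; the integer $\sum_i u_ia_i$ is the $A$-degree of $\mathbf x^{\mathbf u}$. A Markov basis of $I_A$ is an inclusion-minimal generating set consisting of such binomials, and $\operatorname{Betti}(A)$ is the set of the $A$-degrees of the elements of Markov bases. The following are equivalent. (a) $\mathcal S$ is universally free, i.e. for every arrangement $(b_1,b_2,b_3)$ of $A$ and every $i\in\{1,2\}$, $\operatorname{lcm}(b_i,\gcd(b_{i+1},\dots,b_3))\in\langle b_{i+1},\dots,b_3\rangle$. (b) $\mathcal S$ is Betti divisible, i.e. of any two elements of $\operatorname{Betti}(A)$, one divides the other. (c) There are positive integers $d_1,d_2,d_3,f_3$ with $A=\{d_2d_3,\ d_1d_3,\ f_3d_1d_2\}$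 and $\operatorname{Betti}(A)=\{d_1d_2d_3,\ f_3d_1d_2d_3\}$. Moreover, for all $d_1,d_2,d_3,f_3$ as in (c), the integers $d_1,d_2,d_3$ are pairwise coprime and $\gcd(f_3,d_3)=1$; and, after permuting the indeterminates so that $a_1=d_2d_3$, $a_2=d_1d_3$, $a_3=f_3d_1d_2$, and identifying binomials that differ by a sign, $$\mathcal M_A=\operatorname{Cr}_A=\operatorname{Gr}_A=\{x_1^{d_1}-x_2^{d_2}\}\cup\{x_3^{d_3}-x_1^{kd_1}x_2^{(f_3-k)d_2} : 0\le k\le f_3\},$$ a set with $f_3+2$ elements, and $$\mathcal U_A=\mathcal C_A=\{x_1^{d_1}-x_2^{d_2},\ x_1^{f_3d_1}-x_3^{d_3},\ x_2^{f_3d_2}-x_3^{d_3}\},$$ a set with three elements. Here $\mathcal M_A$ is the union of all Markov bases of $I_A$. $\operatorname{Cr}_A$ is the set of critical binomials $x_i^{c_i}-\prod_{j\ne i}x_j^{r_j}\in I_A$, where $c_i$ is the least positive integer with $c_ia_i\in\langle a_j: j\ne i\rangle$. $\operatorname{Gr}_A$ is the Graver basis: the nonzero binomials $\mathbf x^{\mathbf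 u}-\mathbf x^{\mathbf v}\in I_A$ for which no other nonzero binomial $\mathbf x^{\mathbf w}-\mathbf x^{\mathbf z}\in I_A$ satisfies $\mathbf x^{\mathbf w}\mid\mathbf x^{\mathbf u}$ and $\mathbf x^{\mathbf z}\mid\mathbf x^{\mathbf v}$. $\mathcal U_A$ is the union of the reduced Gröbner bases of $I_A$ over all monomial orders. $\mathcal C_A$ is the set of circuits: the binomials $\mathbf x^{\mathbf u}-\mathbf x^{\mathbf v}\in I_A$ such that $\mathbf x^{\mathbf u},\mathbf x^{\mathbf v}$ have no common variable, the nonzero exponents are relatively prime, and no nonzero binomial of $I_A$ involves a strictly smaller set of variables. -/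

import Mathlib

namespace ToricBases

open MvPolynomial

/-- `(a 0, …, a (n-1))` lists, without repetition, the minimal generating set
`A = {a 0, …, a (n-1)}` of a numerical semigroup `S = ⟨A⟩`: the `a i` are relatively prime
positive integers, and no proper subset of `A` generates the same submonoid of `ℕ`. -/
structure IsMinimalGeneratingSystem {n : ℕ} (a : Fin n → ℕ) : Prop where
  pos : ∀ i, 0 < a i
  injective : Function.Injective a
  gcd_eq_one : Finset.univ.gcd a = 1
  minimal : ∀ B : Set ℕ, B ⊂ Set.range a →
    AddSubmonoid.closure B ≠ AddSubmonoid.closure (Set.range a)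

/-- Freeness for the arrangement `(a 0, …, a (n-1))`:
`lcm (a i, gcd (a (i+1), …, a (n-1))) ∈ ⟨a (i+1), …, a (n-1)⟩` for every `i` but the last. -/
def IsFreeFor {n : ℕ} (a : Fin n → ℕ) : Prop :=
  ∀ i : Fin n, (i : ℕ) + 1 < n →
    Nat.lcm (a i) ((Finset.Ioi i).gcd a) ∈ AddSubmonoid.closure (a '' Set.Ioi i)

/-- The semigroup generated by the `a i` is free for every arrangement of `a 0, …, a (n-1)`. -/
def IsUniversallyFree {n : ℕ} (a : Fin n → ℕ) : Prop :=
  ∀ σ : Equiv.Perm (Fin n), IsFreeFor (a ∘ σ)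

/-- The `A`-degree of the monomial with exponent vector `u`. -/
def aDegree {n : ℕ} (a : Fin n → ℕ) (u : Fin n →₀ ℕ) : ℕ := ∑ i, u i * a i

/-- The pure difference binomial `x^u - x^v`. -/
noncomputable def binom (K : Type*) [Field K] {n : ℕ} (u v : Fin n →₀ ℕ) :
    MvPolynomial (Fin n) K :=
  monomial u 1 - monomial v 1

/-- The toric ideal `I_A`. -/
noncomputable def toricIdeal (K : Type*) [Field K] {n : ℕ} (a : Fin n → ℕ) :
    Ideal (MvPolynomial (Fin n) K) :=
  Ideal.span {f | ∃ u v, aDegree a u = aDegree a v ∧ f = binom K u v}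

/-- A Markov basis: a generating set of `I_A` made of pure difference binomials that is minimal
with respect to inclusion among the generating sets. -/
def IsMarkovBasis (K : Type*) [Field K] {n : ℕ} (a : Fin n → ℕ)
    (M : Set (MvPolynomial (Fin n) K)) : Prop :=
  (∀ f ∈ M, ∃ u v, f = binom K u v) ∧ Ideal.span M = toricIdeal K a ∧
    ∀ N, N ⊂ M → Ideal.span N ≠ toricIdeal K a

/-- The Betti degrees: the `A`-degrees of the elements of Markov bases of `I_A`. -/
def bettiDegrees (K : Type*) [Field K] {n : ℕ} (a : Fin n → ℕ) : Set ℕ :=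
  {b | ∃ M, IsMarkovBasis K a M ∧ ∃ u v, binom K u v ∈ M ∧ aDegree a u = b ∧ aDegree a v = b}

/-- Betti divisibility: the Betti degrees are ordered by divisibility. -/
def IsBettiDivisible (K : Type*) [Field K] {n : ℕ} (a : Fin n → ℕ) : Prop :=
  ∀ b ∈ bettiDegrees K a, ∀ b' ∈ bettiDegrees K a, b ∣ b' ∨ b' ∣ b

/-- The universal Markov basis `M_A`: the union of all Markov bases. -/
def universalMarkovBasis (K : Type*) [Field K] {n : ℕ} (a : Fin n → ℕ) :
    Set (MvPolynomial (Fin n) K) :=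
  {f | ∃ M, IsMarkovBasis K a M ∧ f ∈ M}

/-- The Graver basis `Gr_A`: the primitive binomials `x^u - x^v ≠ 0` of `I_A`, for which no other
nonzero binomial `x^w - x^z` of `I_A` has `x^w ∣ x^u` and `x^z ∣ x^v`. -/
def graverBasis (K : Type*) [Field K] {n : ℕ} (a : Fin n → ℕ) :
    Set (MvPolynomial (Fin n) K) :=
  {f | ∃ u v, f = binom K u v ∧ u ≠ v ∧ binom K u v ∈ toricIdeal K a ∧
    ∀ w z, w ≠ z → binom K w z ∈ toricIdeal K a → w ≤ u → z ≤ v → w = u ∧ z = v}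

/-- The set `Cr_A` of critical binomials: `x_i^c - ∏_{j ≠ i} x_j^(r j)` in `I_A`, where `c` is the
least positive integer with `c * a i ∈ ⟨a j : j ≠ i⟩`. -/
def criticalBinomials (K : Type*) [Field K] {n : ℕ} (a : Fin n → ℕ) :
    Set (MvPolynomial (Fin n) K) :=
  {f | ∃ (i : Fin n) (c : ℕ) (r : Fin n →₀ ℕ),
    IsLeast {c : ℕ | 0 < c ∧ c * a i ∈ AddSubmonoid.closure (a '' {j | j ≠ i})} c ∧
    r i = 0 ∧ c * a i = aDegree a r ∧ f = binom K (Finsupp.single i c) r}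

/-- The set `C_A` of circuits: the irreducible binomials of `I_A` (disjoint supports, relatively
prime exponents) of minimal support among the nonzero binomials of `I_A`. -/
def circuits (K : Type*) [Field K] {n : ℕ} (a : Fin n → ℕ) :
    Set (MvPolynomial (Fin n) K) :=
  {f | ∃ u v, f = binom K u v ∧ binom K u v ∈ toricIdeal K a ∧
    Disjoint u.support v.support ∧ Finset.univ.gcd (⇑(u + v)) = 1 ∧
    ∀ u' v', u' ≠ v' → binom K u' v' ∈ toricIdeal K a →
      ¬ (u'.support ∪ v'.support ⊂ u.support ∪ v.support)}

/-- The initial ideal of `I` with respect to a monomial order. -/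
noncomputable def initialIdeal {K : Type*} [Field K] {n : ℕ} (m : MonomialOrder (Fin n))
    (I : Ideal (MvPolynomial (Fin n) K)) : Ideal (MvPolynomial (Fin n) K) :=
  Ideal.span {p | ∃ f ∈ I, f ≠ 0 ∧ p = monomial (m.degree f) 1}

/-- `G` is the reduced Gröbner basis of `I` with respect to `m`: its leading monomials generate
the initial ideal, its elements are monic, and no monomial of an element is divisible by the
leading monomial of another element. -/
def IsReducedGroebnerBasis {K : Type*} [Field K] {n : ℕ} (m : MonomialOrder (Fin n))
    (I : Ideal (MvPolynomial (Fin n) K)) (G : Set (MvPolynomial (Fin n) K)) : Prop :=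
  G.Finite ∧ G ⊆ (I : Set (MvPolynomial (Fin n) K)) ∧
    Ideal.span ((fun g => monomial (m.degree g) (1 : K)) '' G) = initialIdeal m I ∧
    (∀ g ∈ G, m.Monic g) ∧
    ∀ g ∈ G, ∀ h ∈ G, h ≠ g → ∀ u ∈ g.support, ¬ m.degree h ≤ u

/-- The universal Gröbner basis `U_A`: the union of all reduced Gröbner bases of `I_A`. (Since
`m.syn` is a copy of `Fin n →₀ ℕ`, orders with `m.syn` in the lowest universe are all of them.) -/
def universalGroebnerBasis (K : Type*) [Field K] {n : ℕ} (a : Fin n → ℕ) :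
    Set (MvPolynomial (Fin n) K) :=
  {f | ∃ (m : MonomialOrder.{0, 0} (Fin n)) (G : Set (MvPolynomial (Fin n) K)),
    IsReducedGroebnerBasis m (toricIdeal K a) G ∧ f ∈ G}

/-- A set of polynomials with `f` and `-f` identified: the set of the classes `{f, -f}`. -/
def upToSign {R : Type*} [Ring R] (B : Set R) : Set (Set R) :=
  (fun f => {f, -f}) '' B

end ToricBases

namespace ToricBases

open MvPolynomial

/-! ### A-degrees, and the binomials of toric ideals in any number of variables. -/

section General

variable {K : Type*} [Field K] {n : ℕ} {a : Fin n → ℕ}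

/-! Everything passes through one normal form, `IsArranged`: generators d₂d₃, d₁d₃, f d₁d₂ with the
dᵢ pairwise coprime and f coprime to d₃. Reducing an equality of A-degrees modulo d₁, d₂ and d₃
shows that corresponding exponents agree modulo these numbers. Once the common remainders are
removed, the exponents are (d₁P, d₂Q, d₃R) and only P + Q + fR counts
(`IsArranged.exists_of_aDegree_eq`). The ideal thus behaves like the one for the weights (1, 1, f),
whose primitive binomials are found by hand (`IsArranged.isListedPair_of_isPrimitivePair`).

For positive weights, Markov bases and critical binomials always lie in the Graver basis. Here every
listed binomial is critical, and it belongs to a two-element Markov basis, so the three sets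
coincide up to sign. Reduced Gröbner bases also consist of primitive binomials. A binomial with a
mixed term x₁^{kd₁}x₂^{ld₂}, k, l > 0, is excluded because x₁^{d₁} and x₂^{d₂} would both be
smallest in their common degree. Lexicographic orders realise the three remaining binomials, which
are also the circuits.

For the equivalences, put bᵢ = gcd(aⱼ, aₖ)aᵢ. Two equal bᵢ already produce the normal form
(`IsMinimalGeneratingSystem.exists_isArranged`). Universal freeness writes each bᵢ as a nonnegative
integer combination of the other two, so the smallest two agree. If instead the Betti degrees form a
divisibility chain, consider the critical degrees cᵢaᵢ, which are Betti degrees. The largest is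
divisible by all generators and bounded by its lcms with the others, so two lcms agree, which again
equates two bᵢ. Conversely, the normal form gives freeness and both Betti degrees directly. -/

theorem aDegree_add (u v : Fin n →₀ ℕ) : aDegree a (u + v) = aDegree a u + aDegree a v := by
  simp [aDegree, add_mul, Finset.sum_add_distrib]

@[simp] theorem aDegree_zero : aDegree a 0 = 0 := by simp [aDegree]

theorem aDegree_single (i : Fin n) (c : ℕ) : aDegree a (Finsupp.single i c) = c * a i := by
  classical
  simp [aDegree, Finsupp.single_apply, ite_mul]

theorem aDegree_eq_weight (u : Fin n →₀ ℕ) : aDegree a u = Finsupp.weight a u := by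
  simp [aDegree, Finsupp.weight_apply, Finsupp.sum_fintype]

theorem aDegree_mono {u v : Fin n →₀ ℕ} (h : u ≤ v) : aDegree a u ≤ aDegree a v :=
  Finset.sum_le_sum fun i _ => Nat.mul_le_mul_right _ (h i)

theorem aDegree_eq_zero_iff (ha : ∀ i, 0 < a i) {u : Fin n →₀ ℕ} : aDegree a u = 0 ↔ u = 0 := by
  constructor
  · intro h
    ext i
    have := (Finset.sum_eq_zero_iff.1 h) i (Finset.mem_univ i)
    have h1 := ha i
    rcases Nat.mul_eq_zero.1 this with h2 | h2
    · simpa using h2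
    · omega
  · rintro rfl
    simp

theorem eq_of_le_of_aDegree_eq (ha : ∀ i, 0 < a i) {u v : Fin n →₀ ℕ} (h : u ≤ v)
    (hd : aDegree a u = aDegree a v) : u = v := by
  obtain ⟨w, rfl⟩ := exists_add_of_le h
  rw [aDegree_add] at hd
  have : w = 0 := (aDegree_eq_zero_iff ha).1 (by omega)
  simp [this]

theorem binom_self (u : Fin n →₀ ℕ) : binom K u u = 0 := sub_self _

theorem neg_binom (u v : Fin n →₀ ℕ) : -binom K u v = binom K v u := neg_sub _ _

theorem coeff_binom (u v w : Fin n →₀ ℕ) :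
    coeff w (binom K u v) = (if u = w then 1 else 0) - (if v = w then 1 else 0) := by
  classical
  simp [binom, coeff_monomial]

theorem support_binom {u v : Fin n →₀ ℕ} (h : u ≠ v) : (binom K u v).support = {u, v} := by
  classical
  ext w
  rw [mem_support_iff, coeff_binom]
  simp only [Finset.mem_insert, Finset.mem_singleton]
  by_cases h1 : u = w <;> by_cases h2 : v = w <;> grind

theorem binom_ne_zero {u v : Fin n →₀ ℕ} (h : u ≠ v) : binom K u v ≠ 0 := by
  classical
  rw [← support_nonempty, support_binom h]
  simp

theorem eq_or_eq_of_binom_eq {u v u' v' : Fin n →₀ ℕ} (h : u ≠ v)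
    (he : binom K u v = binom K u' v') : (u' = u ∧ v' = v) ∨ (u' = v ∧ v' = u) := by
  classical
  have h' : u' ≠ v' := by
    rintro rfl
    rw [binom_self] at he
    exact binom_ne_zero h he
  have := support_binom (K := K) h
  rw [he, support_binom h'] at this
  have h1 : u' ∈ ({u, v} : Finset _) := this ▸ by simp
  have h2 : v' ∈ ({u, v} : Finset _) := this ▸ by simp
  simp only [Finset.mem_insert, Finset.mem_singleton] at h1 h2
  grind

/-- The substitution xᵢ ↦ t^{aᵢ} kills the toric ideal, so the coefficients of `f` in each A-degree
sum to zero. A monomial alone in its degree could not cancel. -/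
theorem exists_mem_support_of_mem_toricIdeal {f : MvPolynomial (Fin n) K}
    (hf : f ∈ toricIdeal K a) {e : Fin n →₀ ℕ} (he : e ∈ f.support) :
    ∃ e' ∈ f.support, e' ≠ e ∧ aDegree a e' = aDegree a e := by
  classical
  let φ : MvPolynomial (Fin n) K →ₐ[K] Polynomial K := aeval fun i => Polynomial.X ^ a i
  have hφ : ∀ u r, φ (monomial u r) = Polynomial.monomial (aDegree a u) r := by
    intro u r
    rw [aeval_monomial, Finsupp.prod_fintype _ _ (by simp), ← Polynomial.C_mul_X_pow_eq_monomial]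
    simp [aDegree, ← pow_mul, Finset.prod_pow_eq_pow_sum, mul_comm]
  have hker : toricIdeal K a ≤ RingHom.ker φ := by
    refine Ideal.span_le.2 ?_
    rintro _ ⟨u, v, h, rfl⟩
    simp [RingHom.mem_ker, binom, hφ, h]
  have h0 : φ f = 0 := hker hf
  rw [f.as_sum, map_sum] at h0
  have h1 := congrArg (fun p => Polynomial.coeff p (aDegree a e)) h0
  simp only [hφ, Polynomial.finsetSum_coeff, Polynomial.coeff_monomial,
    Polynomial.coeff_zero] at h1
  by_contra! hcon
  rw [Finset.sum_eq_single_of_mem e he] at h1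
  · simp only [if_true] at h1
    exact (mem_support_iff.1 he) h1
  · intro e' he' hne
    rw [if_neg (hcon e' he' hne)]

theorem binom_mem_of_aDegree_eq {u v : Fin n →₀ ℕ} (h : aDegree a u = aDegree a v) :
    binom K u v ∈ toricIdeal K a := Ideal.subset_span ⟨u, v, h, rfl⟩

theorem binom_mem_iff {u v : Fin n →₀ ℕ} :
    binom K u v ∈ toricIdeal K a ↔ aDegree a u = aDegree a v := by
  classical
  refine ⟨fun h => ?_, binom_mem_of_aDegree_eq⟩
  by_cases huv : u = v
  · rw [huv]
  · obtain ⟨e', h1, h2, h3⟩ := exists_mem_support_of_mem_toricIdeal h (e := u)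
      (by simp [support_binom huv])
    simp only [support_binom huv, Finset.mem_insert, Finset.mem_singleton] at h1
    rcases h1 with rfl | rfl
    · exact absurd rfl h2
    · exact h3.symm

theorem upToSign_subset {R : Type*} [Ring R] {S T : Set R} (h : ∀ f ∈ S, f ∈ T ∨ -f ∈ T) :
    upToSign S ⊆ upToSign T := by
  rintro _ ⟨f, hf, rfl⟩
  rcases h f hf with h | h
  · exact ⟨f, h, rfl⟩
  · exact ⟨-f, h, by simp [Set.pair_comm]⟩

/-- The exponent pairs of the primitive binomials. -/
def IsPrimitivePair (a : Fin n → ℕ) (u v : Fin n →₀ ℕ) : Prop :=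
  u ≠ v ∧ aDegree a u = aDegree a v ∧
    ∀ w z, w ≠ z → aDegree a w = aDegree a z → w ≤ u → z ≤ v → w = u ∧ z = v

theorem mem_graverBasis_iff {f : MvPolynomial (Fin n) K} :
    f ∈ graverBasis K a ↔ ∃ u v, f = binom K u v ∧ IsPrimitivePair a u v := by
  simp only [graverBasis, Set.mem_ofPred_eq, binom_mem_iff, IsPrimitivePair]

theorem weightedHomogeneousComponent_monomial_mul (c : ℕ) (s : Fin n →₀ ℕ) (r : K)
    (p : MvPolynomial (Fin n) K) :
    weightedHomogeneousComponent a c (monomial s r * p) =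
      if aDegree a s ≤ c then
        monomial s r * weightedHomogeneousComponent a (c - aDegree a s) p else 0 := by
  classical
  ext d
  rw [coeff_weightedHomogeneousComponent, coeff_monomial_mul']
  by_cases hs : s ≤ d
  · obtain ⟨t, rfl⟩ := exists_add_of_le hs
    have : Finsupp.weight a (s + t) = aDegree a s + aDegree a t := by
      rw [← aDegree_eq_weight, aDegree_add]
    rw [this]
    split_ifs with h1 h2 h2
    · rw [coeff_monomial_mul', if_pos hs, coeff_weightedHomogeneousComponent, if_pos]
      rw [← aDegree_eq_weight]
      simp
      omega
    · omega
    · rw [coeff_monomial_mul', if_pos hs, coeff_weightedHomogeneousComponent, if_neg]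
      · simp
      rw [← aDegree_eq_weight]
      simp
      omega
    · simp
  · split_ifs <;> simp [coeff_monomial_mul', hs]

theorem isWeightedHomogeneous_binom {u v : Fin n →₀ ℕ} (h : aDegree a u = aDegree a v) :
    IsWeightedHomogeneous a (binom K u v) (aDegree a u) :=
  (weightedHomogeneousSubmodule K a _).sub_mem
    (isWeightedHomogeneous_monomial _ _ _ (aDegree_eq_weight u).symm)
    (isWeightedHomogeneous_monomial _ _ _ (by rw [h, aDegree_eq_weight]))

/-- An element of a set of homogeneous binomials is not needed to generate components of lower
degree. -/
theorem weightedHomogeneousComponent_mem_span_diff {M : Set (MvPolynomial (Fin n) K)}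
    (hM : ∀ f ∈ M, ∃ u v, f = binom K u v ∧ aDegree a u = aDegree a v)
    {u v : Fin n →₀ ℕ} (huv : aDegree a u = aDegree a v) {p : MvPolynomial (Fin n) K}
    (hp : p ∈ Ideal.span M) :
    ∀ c < aDegree a u, weightedHomogeneousComponent a c p ∈ Ideal.span (M \ {binom K u v}) := by
  classical
  -- The removed generator contributes nothing below its own degree. Coefficients are split into
  -- monomials, since a monomial factor only shifts degrees.
  refine Submodule.span_induction (p := fun p _ => ∀ c < aDegree a u,
    weightedHomogeneousComponent a c p ∈ Ideal.span (M \ {binom K u v})) ?_ ?_ ?_ ?_ hp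
  · intro g hg c hc
    obtain ⟨w, z, rfl, hwz⟩ := hM g hg
    by_cases h : binom K w z = binom K u v
    · rw [h, weightedHomogeneousComponent_of_mem (isWeightedHomogeneous_binom huv), if_neg hc.ne]
      exact Ideal.zero_mem _
    · rw [weightedHomogeneousComponent_of_mem (isWeightedHomogeneous_binom hwz)]
      split_ifs
      · exact Ideal.subset_span ⟨hg, h⟩
      · exact Ideal.zero_mem _
  · intro c _
    simp
  · intro x y _ _ hx hy c hc
    rw [map_add]
    exact Ideal.add_mem _ (hx c hc) (hy c hc)
  · intro q x _ hx
    rw [smul_eq_mul]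
    induction q using MvPolynomial.induction_on' with
    | monomial s r =>
      intro c hc
      rw [weightedHomogeneousComponent_monomial_mul]
      split_ifs
      · exact Ideal.mul_mem_left _ _ (hx _ (by omega))
      · exact Ideal.zero_mem _
    | add p q hp hq =>
      intro c hc
      rw [add_mul, map_add]
      exact Ideal.add_mem _ (hp c hc) (hq c hc)

theorem IsMarkovBasis.mem_toricIdeal {M : Set (MvPolynomial (Fin n) K)}
    (hM : IsMarkovBasis K a M) {f : MvPolynomial (Fin n) K} (hf : f ∈ M) : f ∈ toricIdeal K a :=
  hM.2.1 ▸ Ideal.subset_span hf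

theorem IsMarkovBasis.not_mem_span_diff {M : Set (MvPolynomial (Fin n) K)}
    (hM : IsMarkovBasis K a M) {f : MvPolynomial (Fin n) K} (hf : f ∈ M) :
    f ∉ Ideal.span (M \ {f}) := by
  intro h
  refine hM.2.2 (M \ {f}) ⟨Set.sdiff_subset, fun h' => (h' hf).2 rfl⟩ ?_
  refine le_antisymm (hM.2.1 ▸ Ideal.span_mono Set.sdiff_subset) ?_
  rw [← hM.2.1]
  refine Ideal.span_le.2 fun g hg => ?_
  by_cases hgf : g = f
  · exact hgf ▸ h
  · exact Ideal.subset_span ⟨hg, hgf⟩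

theorem IsMarkovBasis.mem_span_diff_of_lt {M : Set (MvPolynomial (Fin n) K)}
    (hM : IsMarkovBasis K a M) {u v w z : Fin n →₀ ℕ} (huv : aDegree a u = aDegree a v)
    (hwz : aDegree a w = aDegree a z) (hlt : aDegree a w < aDegree a u) :
    binom K w z ∈ Ideal.span (M \ {binom K u v}) := by
  have := weightedHomogeneousComponent_mem_span_diff (M := M) (K := K) (fun f hf => by
    obtain ⟨s, t, rfl⟩ := hM.1 f hf
    exact ⟨s, t, rfl, binom_mem_iff.1 (hM.mem_toricIdeal hf)⟩) huv
    (p := binom K w z) (by rw [hM.2.1]; exact binom_mem_of_aDegree_eq hwz) _ hlt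
  rwa [weightedHomogeneousComponent_eq_self (isWeightedHomogeneous_binom hwz)] at this

/-- Telescoping through the intermediate monomial with exponent `z + w'`. -/
theorem binom_add_add (w z w' z' : Fin n →₀ ℕ) :
    binom K (w + w') (z + z') = monomial w' 1 * binom K w z + monomial z 1 * binom K w' z' := by
  simp only [binom, mul_sub, monomial_mul, mul_one]
  rw [add_comm w w', add_comm w' z]
  ring

/-- A binomial of I_A properly below `x^u - x^v` leaves a complementary binomial, also in I_A. Both
have smaller degree, so both are generated without `x^u - x^v`. By `binom_add_add`, that element
would then be redundant in its Markov basis. -/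
theorem universalMarkovBasis_subset_graverBasis (ha : ∀ i, 0 < a i) :
    universalMarkovBasis K a ⊆ graverBasis K a := by
  rintro f ⟨M, hM, hf⟩
  obtain ⟨u, v, rfl⟩ := hM.1 f hf
  have hne : u ≠ v := by
    rintro rfl
    refine hM.not_mem_span_diff hf ?_
    rw [binom_self]
    exact Ideal.zero_mem _
  have hd := binom_mem_iff.1 (hM.mem_toricIdeal hf)
  refine mem_graverBasis_iff.2 ⟨u, v, rfl, hne, hd, fun w z hwz hdeg hwu hzv => ?_⟩
  have hmono := aDegree_mono (a := a) hwu
  have hw0 : aDegree a w ≠ 0 := fun h => hwz <| by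
    rw [(aDegree_eq_zero_iff ha).1 h, (aDegree_eq_zero_iff ha).1 (hdeg.symm.trans h)]
  rcases hmono.eq_or_lt with h | h
  · exact ⟨eq_of_le_of_aDegree_eq ha hwu h,
      eq_of_le_of_aDegree_eq ha hzv (by rw [← hdeg, h, hd])⟩
  · exfalso
    obtain ⟨w', rfl⟩ := exists_add_of_le hwu
    obtain ⟨z', rfl⟩ := exists_add_of_le hzv
    have hd' := hd
    rw [aDegree_add, aDegree_add] at hd'
    have h1 := hM.mem_span_diff_of_lt hd hdeg h
    have h2 := hM.mem_span_diff_of_lt (w := w') (z := z') hd (by omega)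
      (by rw [aDegree_add]; omega)
    refine hM.not_mem_span_diff hf ?_
    have h3 := Ideal.add_mem _ (Ideal.mul_mem_left _ (monomial w' 1) h1)
      (Ideal.mul_mem_left _ (monomial z 1) h2)
    rwa [← binom_add_add] at h3

theorem mem_closure_image_iff {s : Set (Fin n)} {d : ℕ} :
    d ∈ AddSubmonoid.closure (a '' s) ↔
      ∃ r : Fin n →₀ ℕ, (∀ i ∉ s, r i = 0) ∧ d = aDegree a r := by
  constructor
  · intro h
    induction h using AddSubmonoid.closure_induction with
    | mem x hx =>
      obtain ⟨i, hi, rfl⟩ := hx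
      refine ⟨Finsupp.single i 1, fun j hj => ?_, by rw [aDegree_single, one_mul]⟩
      rw [Finsupp.single_apply, if_neg]
      rintro rfl
      exact hj hi
    | zero => exact ⟨0, by simp, by simp⟩
    | add x y _ _ hx hy =>
      obtain ⟨r, hr, rfl⟩ := hx
      obtain ⟨r', hr', rfl⟩ := hy
      exact ⟨r + r', fun i hi => by simp [hr i hi, hr' i hi], by rw [aDegree_add]⟩
  · rintro ⟨r, hr, rfl⟩
    refine AddSubmonoid.sum_mem _ fun i _ => ?_
    by_cases hi : i ∈ s
    · exact AddSubmonoid.nsmul_mem _ (AddSubmonoid.subset_closure (Set.mem_image_of_mem a hi)) _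
    · simp [hr i hi]

/-- The least positive multiple of `a i` in the semigroup of the other generators. -/
def IsCritical (a : Fin n → ℕ) (i : Fin n) (c : ℕ) : Prop :=
  IsLeast {c : ℕ | 0 < c ∧ c * a i ∈ AddSubmonoid.closure (a '' {j | j ≠ i})} c

/-- Cancelling the power of xᵢ in `r` leaves a smaller, still positive multiple of `a i` in the
semigroup of the other generators. Hence no power of xᵢ below `c` shares its degree with another
monomial. -/
theorem IsCritical.le_of_aDegree_eq {i : Fin n} {c : ℕ} (hc : IsCritical a i c) {c' : ℕ}
    {r : Fin n →₀ ℕ} (hne : Finsupp.single i c' ≠ r) (ha : ∀ i, 0 < a i)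
    (h : c' * a i = aDegree a r) : c ≤ c' := by
  have hlt : r i < c' := by
    by_contra! hge
    refine hne (eq_of_le_of_aDegree_eq ha ?_ (by rw [aDegree_single, h]))
    rwa [Finsupp.single_le_iff]
  have hsum : r = Finsupp.single i (r i) + r.erase i := (Finsupp.single_add_erase i r).symm
  have : c ≤ c' - r i := by
    refine hc.2 (show 0 < c' - r i ∧ _ from
      ⟨by omega, mem_closure_image_iff.2 ⟨r.erase i, ?_, ?_⟩⟩)
    · intro j hj
      simp only [Set.mem_ofPred_eq, not_not] at hj
      simp [hj]
    · rw [hsum, aDegree_add, aDegree_single] at h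
      rw [Nat.sub_mul]
      omega
  omega

/-- Any smaller binomial has a power of xᵢ as its first term, and minimality of `c` forces the full
power. -/
theorem criticalBinomials_subset_graverBasis (ha : ∀ i, 0 < a i) :
    criticalBinomials K a ⊆ graverBasis K a := by
  rintro f ⟨i, c, r, hc, hr, hd, rfl⟩
  have hne : Finsupp.single i c ≠ r := by
    intro h
    have := hc.1.1
    rw [← h, Finsupp.single_eq_same] at hr
    omega
  refine mem_graverBasis_iff.2 ⟨_, _, rfl, hne, by rw [aDegree_single, hd], ?_⟩
  intro w z hwz hdeg hw hz
  have hw' : w = Finsupp.single i (w i) := by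
    ext j
    by_cases hj : j = i
    · simp [hj]
    · have := hw j
      rw [Finsupp.single_apply, if_neg (Ne.symm hj)] at this ⊢
      omega
  have hle : c ≤ w i := by
    refine IsCritical.le_of_aDegree_eq hc (r := z) (by rwa [← hw']) ha ?_
    rw [← aDegree_single, ← hw', hdeg]
  have hwi := hw i
  rw [Finsupp.single_eq_same] at hwi
  have : w = Finsupp.single i c := by rw [hw', show w i = c by omega]
  refine ⟨this, eq_of_le_of_aDegree_eq ha hz ?_⟩
  rw [← hdeg, this, aDegree_single, hd]

/-- By Noetherianity finitely many of the defining binomials suffice; take a generating subset of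
these minimal for inclusion. -/
theorem exists_isMarkovBasis (K : Type*) [Field K] {n : ℕ} (a : Fin n → ℕ) :
    ∃ M, IsMarkovBasis K a M := by
  classical
  have hfg : (toricIdeal K a).FG := IsNoetherian.noetherian _
  obtain ⟨s, hs, hspan⟩ := (Submodule.fg_span_iff_fg_span_finset_subset _).1 hfg
  have hne : {t : Finset (MvPolynomial (Fin n) K) |
    t ⊆ s ∧ Ideal.span (t : Set _) = toricIdeal K a}.Nonempty :=
      ⟨s, subset_rfl, hspan.symm⟩
  obtain ⟨t, ht⟩ := WellFounded.has_min (α := Finset (MvPolynomial (Fin n) K))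
    wellFounded_lt _ hne
  refine ⟨t, fun f hf => ?_, ht.1.2, fun N hN hspanN => ?_⟩
  · obtain ⟨u, v, -, h⟩ := hs (ht.1.1 hf)
    exact ⟨u, v, h⟩
  · have hfin : N.Finite := t.finite_toSet.subset hN.1
    refine ht.2 hfin.toFinset ⟨fun x hx => ht.1.1 (hN.1 (hfin.mem_toFinset.1 hx)), ?_⟩ ?_
    · rwa [hfin.coe_toFinset]
    · rw [← Finset.coe_ssubset, hfin.coe_toFinset]
      exact hN

/-- A divisor of xᵢ^c shares its degree with another monomial only if it is xᵢ^c itself. If no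
Markov element had degree `c * a i`, the ideal would lie in the monomial ideal of the non-divisors
of xᵢ^c. But it contains a binomial with the term xᵢ^c. -/
theorem IsCritical.mem_bettiDegrees (K : Type*) [Field K] (ha : ∀ i, 0 < a i) {i : Fin n} {c : ℕ}
    (hc : IsCritical a i c) : c * a i ∈ bettiDegrees K a := by
  classical
  obtain ⟨M, hM⟩ := exists_isMarkovBasis K a
  refine ⟨M, hM, ?_⟩
  by_contra! hcon
  let S : Set (Fin n →₀ ℕ) := {w | ¬ w ≤ Finsupp.single i c}
  have key : ∀ w z : Fin n →₀ ℕ, w ≠ z → aDegree a w = aDegree a z → aDegree a w ≠ c * a i →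
      w ∈ S := by
    intro w z hwz hdeg hne hw
    have hw' : w = Finsupp.single i (w i) := by
      ext j
      by_cases hj : j = i
      · simp [hj]
      · have := hw j
        rw [Finsupp.single_apply, if_neg (Ne.symm hj)] at this ⊢
        omega
    have hle : c ≤ w i := by
      refine IsCritical.le_of_aDegree_eq hc (r := z) (by rwa [← hw']) ha ?_
      rw [← aDegree_single, ← hw', hdeg]
    have hwi := hw i
    rw [Finsupp.single_eq_same] at hwi
    refine hne ?_
    rw [hw', aDegree_single, show w i = c by omega]
  have hle : toricIdeal K a ≤ Ideal.span ((fun s => monomial s (1 : K)) '' S) := by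
    rw [← hM.2.1]
    refine Ideal.span_le.2 fun g hg => ?_
    obtain ⟨w, z, rfl⟩ := hM.1 g hg
    have hdeg := binom_mem_iff.1 (hM.mem_toricIdeal hg)
    by_cases hwz : w = z
    · rw [hwz, binom_self]
      exact Ideal.zero_mem _
    have hne : aDegree a w ≠ c * a i := fun h => hcon w z hg h (hdeg ▸ h)
    exact Ideal.sub_mem _ (Ideal.subset_span ⟨w, key w z hwz hdeg hne, rfl⟩)
      (Ideal.subset_span ⟨z, key z w (Ne.symm hwz) hdeg.symm (hdeg ▸ hne), rfl⟩)
  obtain ⟨r, hr, hd⟩ := mem_closure_image_iff.1 hc.1.2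
  have hne : Finsupp.single i c ≠ r := by
    intro h
    have h0 := hc.1.1
    have := hr i (by simp)
    rw [← h, Finsupp.single_eq_same] at this
    omega
  have hmem := hle (binom_mem_of_aDegree_eq (K := K) (u := Finsupp.single i c) (v := r)
    (by rw [aDegree_single, hd]))
  rw [mem_ideal_span_monomial_image] at hmem
  obtain ⟨s, hs, hs'⟩ := hmem (Finsupp.single i c) (by simp [support_binom hne])
  exact hs hs'

theorem exists_isCritical (ha : ∀ i, 0 < a i) {i j : Fin n} (hij : i ≠ j) :
    ∃ c, IsCritical a i c := by
  classical
  have h : ∃ c, 0 < c ∧ c * a i ∈ AddSubmonoid.closure (a '' {j | j ≠ i}) := by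
    refine ⟨a j, ha j, ?_⟩
    rw [mul_comm]
    exact AddSubmonoid.nsmul_mem _ (AddSubmonoid.subset_closure (Set.mem_image_of_mem a hij.symm)) _
  exact ⟨Nat.find h, Nat.find_spec h, fun _ hc => Nat.find_min' h hc⟩

end General

/-! ### Reduced Gröbner bases of toric ideals, described by smallest elements of fibres. -/

section Groebner

open scoped MonomialOrder

variable {K : Type*} [Field K] {n : ℕ} {a : Fin n → ℕ} {m : MonomialOrder (Fin n)}

/-- `v` is the smallest exponent of its `A`-degree for the monomial order `m`. -/
def IsFiberMin (m : MonomialOrder (Fin n)) (a : Fin n → ℕ) (v : Fin n →₀ ℕ) : Prop :=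
  ∀ w, aDegree a w = aDegree a v → v ≼[m] w

theorem toSyn_mono {u v : Fin n →₀ ℕ} (h : u ≤ v) : u ≼[m] v := m.toSyn_monotone h

theorem eq_of_toSyn_le {u v : Fin n →₀ ℕ} (h : u ≼[m] v) (h' : v ≼[m] u) : u = v :=
  m.toSyn.injective (le_antisymm h h')

theorem IsFiberMin.of_le {u v : Fin n →₀ ℕ} (hv : IsFiberMin m a v) (h : u ≤ v) :
    IsFiberMin m a u := by
  obtain ⟨t, rfl⟩ := exists_add_of_le h
  intro w hw
  have := hv (w + t) (by rw [aDegree_add, aDegree_add, hw])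
  rw [map_add, map_add] at this
  exact le_of_add_le_add_right this

theorem IsFiberMin.eq {u v : Fin n →₀ ℕ} (hu : IsFiberMin m a u) (hv : IsFiberMin m a v)
    (h : aDegree a u = aDegree a v) : u = v :=
  eq_of_toSyn_le (hu _ h.symm) (hv _ h)

theorem exists_isFiberMin (m : MonomialOrder (Fin n)) (a : Fin n → ℕ) (u : Fin n →₀ ℕ) :
    ∃ v, aDegree a v = aDegree a u ∧ IsFiberMin m a v := by
  obtain ⟨x, hx, hmin⟩ := WellFounded.has_min (α := m.syn) wellFounded_lt
    (m.toSyn '' {v | aDegree a v = aDegree a u}) ⟨_, u, rfl, rfl⟩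
  obtain ⟨v, hv, rfl⟩ := hx
  refine ⟨v, hv, fun w hw => not_lt.1 (hmin _ ⟨w, hw.trans hv, rfl⟩)⟩

/-- The leading monomial shares its A-degree with another monomial of `f`, which is smaller. So the
fibre minima are standard monomials. -/
theorem not_isFiberMin_degree {f : MvPolynomial (Fin n) K} (hf : f ∈ toricIdeal K a)
    (h0 : f ≠ 0) : ¬ IsFiberMin m a (m.degree f) := by
  intro h
  obtain ⟨e, he, hne, hd⟩ :=
    exists_mem_support_of_mem_toricIdeal hf (m.degree_mem_support h0)
  exact hne (eq_of_toSyn_le (m.le_degree he) (h e hd))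

theorem degree_binom {u v : Fin n →₀ ℕ} (h : v ≺[m] u) : m.degree (binom K u v) = u := by
  classical
  have hne : u ≠ v := by
    rintro rfl
    exact lt_irrefl _ h
  refine eq_of_toSyn_le (m := m) (m.degree_le_iff.2 fun w hw => ?_)
    (m.le_degree (by simp [support_binom hne]))
  rw [support_binom hne, Finset.mem_insert, Finset.mem_singleton] at hw
  rcases hw with rfl | rfl
  · exact le_rfl
  · exact h.le

theorem monomial_mem_initialIdeal {u : Fin n →₀ ℕ} (h : ¬ IsFiberMin m a u) :
    monomial u (1 : K) ∈ initialIdeal m (toricIdeal K a) := by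
  simp only [IsFiberMin, not_forall, not_le] at h
  obtain ⟨w, hd, hlt⟩ := h
  have hne : u ≠ w := by
    rintro rfl
    exact lt_irrefl _ hlt
  exact Ideal.subset_span ⟨binom K u w, binom_mem_of_aDegree_eq hd.symm, binom_ne_zero hne,
    by rw [degree_binom hlt]⟩

/-- The exponents of the elements of the reduced Gröbner basis of `I_A` for the order `m`. -/
def IsReducedPair (m : MonomialOrder (Fin n)) (a : Fin n → ℕ) (u v : Fin n →₀ ℕ) : Prop :=
  u ≠ v ∧ aDegree a u = aDegree a v ∧ IsFiberMin m a v ∧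
    ∀ w ≤ u, w ≠ u → IsFiberMin m a w

theorem IsReducedPair.lt {u v : Fin n →₀ ℕ} (h : IsReducedPair m a u v) : v ≺[m] u :=
  lt_of_le_of_ne (h.2.2.1 _ h.2.1) fun he => h.1 (m.toSyn.injective he).symm

/-- A proper divisor of `x^u` and any divisor of `x^v` are both fibre minima, so they cannot be
distinct monomials of one degree. -/
theorem IsReducedPair.isPrimitivePair (ha : ∀ i, 0 < a i) {u v : Fin n →₀ ℕ}
    (h : IsReducedPair m a u v) : IsPrimitivePair a u v := by
  refine ⟨h.1, h.2.1, fun w z hwz hd hw hz => ?_⟩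
  have hwu : w = u := by
    by_contra hne
    exact hwz ((h.2.2.2 w hw hne).eq (h.2.2.1.of_le hz) hd)
  subst hwu
  exact ⟨rfl, eq_of_le_of_aDegree_eq ha hz (hd.symm.trans h.2.1)⟩

theorem IsReducedGroebnerBasis.exists_degree_le {G : Set (MvPolynomial (Fin n) K)}
    (hG : IsReducedGroebnerBasis m (toricIdeal K a) G) {u : Fin n →₀ ℕ}
    (h : ¬ IsFiberMin m a u) : ∃ g ∈ G, m.degree g ≤ u := by
  classical
  have := monomial_mem_initialIdeal (K := K) h
  rw [← hG.2.2.1, ← Set.image_image (fun s => monomial s (1 : K)) (fun g => m.degree g),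
    mem_ideal_span_monomial_image] at this
  obtain ⟨_, ⟨g, hg, rfl⟩, hle⟩ := this u (by simp [support_monomial])
  exact ⟨g, hg, hle⟩

/-- Subtract from `g` the binomial made of its leading monomial and the minimum of that fibre. A
nonzero difference would have a leading monomial that is nonstandard and already occurs as a
non-leading term of `g`, against reducedness. -/
theorem IsReducedGroebnerBasis.exists_isReducedPair {G : Set (MvPolynomial (Fin n) K)}
    (hG : IsReducedGroebnerBasis m (toricIdeal K a) G) {g : MvPolynomial (Fin n) K}
    (hg : g ∈ G) : ∃ u v, g = binom K u v ∧ IsReducedPair m a u v := by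
  classical
  have hmonic := hG.2.2.2.1 g hg
  have hred := hG.2.2.2.2 g hg
  have hgI := hG.2.1 hg
  have hg0 : g ≠ 0 := hmonic.ne_zero
  have hu : ¬ IsFiberMin m a (m.degree g) := not_isFiberMin_degree hgI hg0
  obtain ⟨v, hv, hmin⟩ := exists_isFiberMin m a (m.degree g)
  have hne : m.degree g ≠ v := fun h => hu (h ▸ hmin)
  refine ⟨m.degree g, v, ?_, hne, hv.symm, hmin, fun w hw hwne => ?_⟩
  · by_contra hcon
    have hp0 : g - binom K (m.degree g) v ≠ 0 := sub_ne_zero.2 hcon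
    have hpI : g - binom K (m.degree g) v ∈ toricIdeal K a :=
      Ideal.sub_mem _ hgI (binom_mem_of_aDegree_eq hv.symm)
    set e := m.degree (g - binom K (m.degree g) v) with he
    have hemin : ¬ IsFiberMin m a e := not_isFiberMin_degree hpI hp0
    have hec : coeff e (g - binom K (m.degree g) v) ≠ 0 :=
      mem_support_iff.1 (m.degree_mem_support hp0)
    have heu : m.degree g ≠ e := by
      intro h
      rw [← h, coeff_sub, coeff_binom, hmonic.coeff_degree, if_pos rfl, if_neg hne.symm] at hec
      simp at hec
    have hev : v ≠ e := fun h => hemin (h ▸ hmin)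
    rw [coeff_sub, coeff_binom, if_neg heu, if_neg hev, sub_self, sub_zero] at hec
    have hes : e ∈ g.support := mem_support_iff.2 hec
    obtain ⟨h, hh, hle⟩ := hG.exists_degree_le hemin
    by_cases hhg : h = g
    · subst hhg
      exact heu (eq_of_toSyn_le (toSyn_mono hle) (m.le_degree hes))
    · exact hred h hh hhg e hes hle
  · by_contra hcon
    obtain ⟨h, hh, hle⟩ := hG.exists_degree_le hcon
    by_cases hhg : h = g
    · subst hhg
      exact hwne (le_antisymm hw hle)
    · exact hred h hh hhg _ (m.degree_mem_support hg0) (hle.trans hw)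

theorem isReducedGroebnerBasis_setOf_isReducedPair (K : Type*) [Field K] {n : ℕ}
    (m : MonomialOrder (Fin n)) (a : Fin n → ℕ) :
    IsReducedGroebnerBasis m (toricIdeal K a)
      {f | ∃ u v, f = binom K u v ∧ IsReducedPair m a u v} := by
  classical
  have hdiv : ∀ u u' v' : Fin n →₀ ℕ, IsReducedPair m a u' v' → IsFiberMin m a u → ¬ u' ≤ u := by
    intro u u' v' h hu hle
    exact h.1 ((hu.of_le hle).eq h.2.2.1 h.2.1)
  have heq : ∀ u v u' v' : Fin n →₀ ℕ, IsReducedPair m a u v → IsReducedPair m a u' v' →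
      u' ≤ u → binom K u' v' = binom K u v := by
    intro u v u' v' h h' hle
    have huu : u' = u := by
      by_contra hne
      exact hdiv _ _ _ h' (h.2.2.2 _ hle hne) le_rfl
    subst huu
    rw [h.2.2.1.eq h'.2.2.1 (h.2.1.symm.trans h'.2.1)]
  refine ⟨?_, ?_, ?_, ?_, ?_⟩
  · let U : Set (Fin n →₀ ℕ) := {u | ∃ v, IsReducedPair m a u v}
    have hU : U.Finite := by
      -- Dickson's lemma: the leading exponents are pairwise incomparable.
      refine WellQuasiOrderedLE.finite_of_isAntichain ?_
      rintro u ⟨v, hu⟩ u' ⟨v', hu'⟩ hne hle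
      exact hdiv _ _ _ hu (hu'.2.2.2 _ hle hne) le_rfl
    choose! μ hμ using exists_isFiberMin m a
    refine (hU.image fun u => binom K u (μ u)).subset ?_
    rintro _ ⟨u, v, rfl, h⟩
    refine ⟨u, ⟨v, h⟩, ?_⟩
    simp only
    rw [h.2.2.1.eq (hμ u).2 (h.2.1.symm.trans (hμ u).1.symm)]
  · rintro _ ⟨u, v, rfl, h⟩
    exact binom_mem_of_aDegree_eq h.2.1
  · refine le_antisymm (Ideal.span_le.2 ?_) (Ideal.span_le.2 ?_)
    · rintro _ ⟨_, ⟨u, v, rfl, h⟩, rfl⟩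
      exact Ideal.subset_span ⟨_, binom_mem_of_aDegree_eq h.2.1, binom_ne_zero h.1, rfl⟩
    · rintro _ ⟨f, hf, hf0, rfl⟩
      have hmin := not_isFiberMin_degree (m := m) hf hf0
      -- A minimal nonstandard divisor of the leading monomial is the leading term of a reduced
      -- pair.
      obtain ⟨u, ⟨hu, hule⟩, humin⟩ := WellFounded.has_min (α := Fin n →₀ ℕ) wellFounded_lt
        {u | ¬ IsFiberMin m a u ∧ u ≤ m.degree f} ⟨_, hmin, le_rfl⟩
      obtain ⟨v, hv, hvmin⟩ := exists_isFiberMin m a u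
      have hp : IsReducedPair m a u v := by
        refine ⟨fun h => hu (h ▸ hvmin), hv.symm, hvmin, fun w hw hne => ?_⟩
        by_contra hcon
        exact humin w ⟨hcon, hw.trans hule⟩ (lt_of_le_of_ne hw hne)
      obtain ⟨t, ht⟩ := exists_add_of_le hule
      have : monomial (m.degree f) (1 : K) = monomial t 1 * monomial u 1 := by
        rw [monomial_mul, one_mul, ht, add_comm]
      rw [SetLike.mem_coe, this]
      refine Ideal.mul_mem_left _ _ (Ideal.subset_span ⟨binom K u v, ⟨u, v, rfl, hp⟩, ?_⟩)
      simp only [degree_binom hp.lt]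
  · rintro _ ⟨u, v, rfl, h⟩
    rw [MonomialOrder.Monic, MonomialOrder.leadingCoeff, degree_binom h.lt, coeff_binom,
      if_pos rfl, if_neg h.1.symm, sub_zero]
  · rintro _ ⟨u, v, rfl, h⟩ _ ⟨u', v', rfl, h'⟩ hne w hw hle
    rw [degree_binom h'.lt] at hle
    rw [support_binom h.1, Finset.mem_insert, Finset.mem_singleton] at hw
    rcases hw with rfl | rfl
    · exact hne (heq _ _ _ _ h h' hle)
    · exact hdiv _ _ _ h' h.2.2.1 hle

theorem mem_universalGroebnerBasis_iff {f : MvPolynomial (Fin n) K} :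
    f ∈ universalGroebnerBasis K a ↔
      ∃ (m : MonomialOrder.{0, 0} (Fin n)) (u v : Fin n →₀ ℕ),
        f = binom K u v ∧ IsReducedPair m a u v := by
  constructor
  · rintro ⟨m, G, hG, hf⟩
    exact ⟨m, hG.exists_isReducedPair hf⟩
  · rintro ⟨m, u, v, rfl, h⟩
    exact ⟨m, _, isReducedGroebnerBasis_setOf_isReducedPair K m a, u, v, rfl, h⟩

/-- The coordinate `j` is compared last, and at every earlier coordinate the right-hand exponent is
0, so the first difference can only be at `j`. -/
theorem eq_single_of_lex_lt {σ : Type*} [LinearOrder σ] [WellFoundedGT σ] {j : σ}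
    (hj : ∀ i, i ≤ j) {c : ℕ} {w : σ →₀ ℕ}
    (h : w ≺[MonomialOrder.lex] Finsupp.single j c) : w = Finsupp.single j (w j) := by
  classical
  rw [MonomialOrder.lex_lt_iff, Finsupp.Lex.lt_iff] at h
  obtain ⟨i, hlt, hi⟩ := h
  simp only [ofLex_toLex] at hlt hi
  have hij : i = j := by
    by_contra hne
    rw [Finsupp.single_apply, if_neg (Ne.symm hne)] at hi
    omega
  subst hij
  ext k
  by_cases hk : k = i
  · simp [hk]
  · rw [hlt k (lt_of_le_of_ne (hj k) hk)]
    simp [Ne.symm hk]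

/-- There are monomial orders for which a power of a given variable is smaller than any other
monomial of the same `A`-degree. -/
theorem exists_isFiberMin_single (ha : ∀ i, 0 < a i) (j : Fin n) :
    ∃ m : MonomialOrder.{0, 0} (Fin n), ∀ c, IsFiberMin m a (Finsupp.single j c) := by
  classical
  have hn : 0 < n := j.pos
  let last : Fin n := ⟨n - 1, by omega⟩
  let e : Fin n → Fin n := Equiv.swap j last
  have he : Function.Injective e := (Equiv.swap j last).injective
  have hej : ∀ i, e i ≤ e j := by
    intro i
    simp only [e, Equiv.swap_apply_left]
    exact Fin.mk_le_of_le_val (by have := (Equiv.swap j last i).2; simp [last]; omega)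
  -- The variables are reordered so that `j` comes last. The instance is passed explicitly because
  -- `Fin n` already carries its usual order.
  let L : LinearOrder (Fin n) := LinearOrder.lift' e he
  have hwf : @WellFoundedGT (Fin n) L.toLT := @Finite.to_wellFoundedGT _ _ L.toPreorder
  refine ⟨@MonomialOrder.lex (Fin n) L hwf, fun c w hw => ?_⟩
  by_contra hcon
  have h := @eq_single_of_lex_lt (Fin n) L hwf j hej c w (not_le.1 hcon)
  refine hcon (le_of_eq ?_)
  rw [h, aDegree_single, aDegree_single] at hw
  rw [h, Nat.eq_of_mul_eq_mul_right (ha j) hw]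

end Groebner

/-! ### Three variables: the normal form of the generators and its primitive binomials. -/

section ThreeVariables

variable {K : Type*} [Field K]

/-- The exponent vector of `x_{σ 0}^p x_{σ 1}^q x_{σ 2}^r`. -/
noncomputable def expo (σ : Equiv.Perm (Fin 3)) (p q r : ℕ) : Fin 3 →₀ ℕ :=
  Finsupp.equivFunOnFinite.symm (![p, q, r] ∘ σ.symm)

variable {σ : Equiv.Perm (Fin 3)} {p q r p' q' r' : ℕ}

@[simp] theorem expo_apply_zero : expo σ p q r (σ 0) = p := by simp [expo]

@[simp] theorem expo_apply_one : expo σ p q r (σ 1) = q := by simp [expo]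

@[simp] theorem expo_apply_two : expo σ p q r (σ 2) = r := by simp [expo]

theorem forall_perm_fin_three {P : Fin 3 → Prop} (σ : Equiv.Perm (Fin 3)) :
    (∀ t, P t) ↔ P (σ 0) ∧ P (σ 1) ∧ P (σ 2) := by
  rw [← σ.forall_congr_right]
  exact ⟨fun h => ⟨h 0, h 1, h 2⟩, fun h i => by fin_cases i <;> simp [h]⟩

theorem expo_self (σ : Equiv.Perm (Fin 3)) (u : Fin 3 →₀ ℕ) :
    expo σ (u (σ 0)) (u (σ 1)) (u (σ 2)) = u := by
  refine Finsupp.ext ?_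
  rw [forall_perm_fin_three σ]
  simp

theorem exists_eq_expo (σ : Equiv.Perm (Fin 3)) (u : Fin 3 →₀ ℕ) : ∃ p q r, u = expo σ p q r :=
  ⟨_, _, _, (expo_self σ u).symm⟩

theorem expo_inj : expo σ p q r = expo σ p' q' r' ↔ p = p' ∧ q = q' ∧ r = r' := by
  refine ⟨fun h => ⟨?_, ?_, ?_⟩, by rintro ⟨rfl, rfl, rfl⟩; rfl⟩
  · simpa using DFunLike.congr_fun h (σ 0)
  · simpa using DFunLike.congr_fun h (σ 1)
  · simpa using DFunLike.congr_fun h (σ 2)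

theorem expo_le_iff : expo σ p q r ≤ expo σ p' q' r' ↔ p ≤ p' ∧ q ≤ q' ∧ r ≤ r' := by
  rw [Finsupp.le_def, forall_perm_fin_three σ]
  simp

theorem single_zero_eq_expo : Finsupp.single (σ 0) p = expo σ p 0 0 := by
  refine Finsupp.ext ?_
  rw [forall_perm_fin_three σ]
  simp

theorem single_one_eq_expo : Finsupp.single (σ 1) p = expo σ 0 p 0 := by
  refine Finsupp.ext ?_
  rw [forall_perm_fin_three σ]
  simp

theorem single_two_eq_expo : Finsupp.single (σ 2) p = expo σ 0 0 p := by
  refine Finsupp.ext ?_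
  rw [forall_perm_fin_three σ]
  simp

theorem expo_add : expo σ p q r + expo σ p' q' r' = expo σ (p + p') (q + q') (r + r') := by
  refine Finsupp.ext ?_
  rw [forall_perm_fin_three σ]
  simp

theorem monomial_expo :
    monomial (expo σ p q r) (1 : K) = X (σ 0) ^ p * X (σ 1) ^ q * X (σ 2) ^ r := by
  rw [X_pow_eq_monomial, X_pow_eq_monomial, X_pow_eq_monomial, monomial_mul, monomial_mul,
    single_zero_eq_expo, single_one_eq_expo, single_two_eq_expo, expo_add, expo_add]
  simp

theorem aDegree_expo (a : Fin 3 → ℕ) :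
    aDegree a (expo σ p q r) = p * a (σ 0) + q * a (σ 1) + r * a (σ 2) := by
  rw [aDegree, ← Equiv.sum_comp σ, Fin.sum_univ_three]
  simp

/-- The generators are `d₂ d₃, d₁ d₃, f d₁ d₂` in the order given by `σ`, with the coprimality
conditions that hold when they generate a numerical semigroup. -/
structure IsArranged (a : Fin 3 → ℕ) (σ : Equiv.Perm (Fin 3)) (d₁ d₂ d₃ f : ℕ) : Prop where
  pos₁ : 0 < d₁
  pos₂ : 0 < d₂
  pos₃ : 0 < d₃
  pos_f : 0 < f
  coprime₁₂ : Nat.Coprime d₁ d₂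
  coprime₁₃ : Nat.Coprime d₁ d₃
  coprime₂₃ : Nat.Coprime d₂ d₃
  coprime_f₃ : Nat.Coprime f d₃
  eq₁ : a (σ 0) = d₂ * d₃
  eq₂ : a (σ 1) = d₁ * d₃
  eq₃ : a (σ 2) = f * d₁ * d₂

variable {a : Fin 3 → ℕ} {d₁ d₂ d₃ f : ℕ}

namespace IsArranged

theorem pos (h : IsArranged a σ d₁ d₂ d₃ f) : ∀ i, 0 < a i := by
  rw [forall_perm_fin_three σ, h.eq₁, h.eq₂, h.eq₃]
  have h1 := h.pos₁
  have h2 := h.pos₂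
  have h3 := h.pos₃
  have h4 := h.pos_f
  exact ⟨by positivity, by positivity, by positivity⟩

theorem aDegree_expo_mul (h : IsArranged a σ d₁ d₂ d₃ f) (P Q R : ℕ) :
    aDegree a (expo σ (d₁ * P) (d₂ * Q) (d₃ * R)) = (P + Q + f * R) * (d₁ * d₂ * d₃) := by
  rw [aDegree_expo, h.eq₁, h.eq₂, h.eq₃]
  ring

/-- Modulo d₁ only the first term of the degree survives, and its factor d₂d₃ is invertible;
likewise for d₂ and d₃. So the two sides have common remainders `s`, `t`, `w`, and dividing what is
left by d₁d₂d₃ gives the relation with weights (1, 1, f). -/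
theorem exists_of_aDegree_eq (h : IsArranged a σ d₁ d₂ d₃ f)
    (hd : aDegree a (expo σ p q r) = aDegree a (expo σ p' q' r')) :
    ∃ s t w P Q R P' Q' R', p = s + d₁ * P ∧ q = t + d₂ * Q ∧ r = w + d₃ * R ∧
      p' = s + d₁ * P' ∧ q' = t + d₂ * Q' ∧ r' = w + d₃ * R' ∧
      P + Q + f * R = P' + Q' + f * R' := by
  have hd0 := hd
  rw [aDegree_expo, aDegree_expo, h.eq₁, h.eq₂, h.eq₃] at hd
  have h1 : p ≡ p' [MOD d₁] := by
    refine Nat.ModEq.cancel_right_of_coprime (c := d₂ * d₃)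
      (h.coprime₁₂.mul_right h.coprime₁₃) ?_
    have e : ∀ x y z, x * (d₂ * d₃) ≡ x * (d₂ * d₃) + y * (d₁ * d₃) + z * (f * d₁ * d₂)
        [MOD d₁] := fun x y z => by
      rw [show x * (d₂ * d₃) + y * (d₁ * d₃) + z * (f * d₁ * d₂) =
        x * (d₂ * d₃) + d₁ * (y * d₃ + z * f * d₂) by ring]
      simp [Nat.ModEq]
    exact (e p q r).trans ((hd ▸ (e p' q' r').symm))
  have h2 : q ≡ q' [MOD d₂] := by
    refine Nat.ModEq.cancel_right_of_coprime (c := d₁ * d₃)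
      (h.coprime₁₂.symm.mul_right h.coprime₂₃) ?_
    have e : ∀ x y z, y * (d₁ * d₃) ≡ x * (d₂ * d₃) + y * (d₁ * d₃) + z * (f * d₁ * d₂)
        [MOD d₂] := fun x y z => by
      rw [show x * (d₂ * d₃) + y * (d₁ * d₃) + z * (f * d₁ * d₂) =
        y * (d₁ * d₃) + d₂ * (x * d₃ + z * f * d₁) by ring]
      simp [Nat.ModEq]
    exact (e p q r).trans ((hd ▸ (e p' q' r').symm))
  have h3 : r ≡ r' [MOD d₃] := by
    refine Nat.ModEq.cancel_right_of_coprime (c := f * d₁ * d₂)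
      ((h.coprime_f₃.symm.mul_right h.coprime₁₃.symm).mul_right h.coprime₂₃.symm) ?_
    have e : ∀ x y z, z * (f * d₁ * d₂) ≡ x * (d₂ * d₃) + y * (d₁ * d₃) + z * (f * d₁ * d₂)
        [MOD d₃] := fun x y z => by
      rw [show x * (d₂ * d₃) + y * (d₁ * d₃) + z * (f * d₁ * d₂) =
        z * (f * d₁ * d₂) + d₃ * (x * d₂ + y * d₁) by ring]
      simp [Nat.ModEq]
    exact (e p q r).trans ((hd ▸ (e p' q' r').symm))
  have e1 := (Nat.mod_add_div p d₁).symm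
  have e2 := (Nat.mod_add_div q d₂).symm
  have e3 := (Nat.mod_add_div r d₃).symm
  have e1' := (Nat.mod_add_div p' d₁).symm
  have e2' := (Nat.mod_add_div q' d₂).symm
  have e3' := (Nat.mod_add_div r' d₃).symm
  rw [← h1] at e1'
  rw [← h2] at e2'
  rw [← h3] at e3'
  refine ⟨_, _, _, _, _, _, _, _, _, e1, e2, e3, e1', e2', e3', ?_⟩
  rw [e1, e2, e3, e1', e2', e3', ← expo_add, ← expo_add, aDegree_add, aDegree_add,
    h.aDegree_expo_mul, h.aDegree_expo_mul] at hd0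
  have hpos : 0 < d₁ * d₂ * d₃ := Nat.mul_pos (Nat.mul_pos h.pos₁ h.pos₂) h.pos₃
  exact Nat.eq_of_mul_eq_mul_right hpos (Nat.add_left_cancel hd0)

/-- A common remainder vanishes as soon as one of the two exponents is zero. -/
theorem exists_of_disjoint (h : IsArranged a σ d₁ d₂ d₃ f)
    (hd : aDegree a (expo σ p q r) = aDegree a (expo σ p' q' r'))
    (hp : p = 0 ∨ p' = 0) (hq : q = 0 ∨ q' = 0) (hr : r = 0 ∨ r' = 0) :
    ∃ P Q R P' Q' R', p = d₁ * P ∧ q = d₂ * Q ∧ r = d₃ * R ∧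
      p' = d₁ * P' ∧ q' = d₂ * Q' ∧ r' = d₃ * R' ∧
      P + Q + f * R = P' + Q' + f * R' ∧ (P = 0 ∨ P' = 0) ∧ (Q = 0 ∨ Q' = 0) ∧
      (R = 0 ∨ R' = 0) := by
  obtain ⟨s, t, w, P, Q, R, P', Q', R', h1, h2, h3, h4, h5, h6, h7⟩ := h.exists_of_aDegree_eq hd
  have hz : ∀ {d x s P P' : ℕ}, 0 < d → x = s + d * P → x = 0 → s = 0 ∧ P = 0 := by
    intro d x s P _ hd h h'
    have h0 : s = 0 ∧ d * P = 0 := by omega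
    exact ⟨h0.1, (Nat.mul_eq_zero.1 h0.2).resolve_left hd.ne'⟩
  have hp' : s = 0 ∧ (P = 0 ∨ P' = 0) := by
    rcases hp with h0 | h0
    · exact ⟨(hz (P' := 0) h.pos₁ h1 h0).1, .inl (hz (P' := 0) h.pos₁ h1 h0).2⟩
    · exact ⟨(hz (P' := 0) h.pos₁ h4 h0).1, .inr (hz (P' := 0) h.pos₁ h4 h0).2⟩
  have hq' : t = 0 ∧ (Q = 0 ∨ Q' = 0) := by
    rcases hq with h0 | h0
    · exact ⟨(hz (P' := 0) h.pos₂ h2 h0).1, .inl (hz (P' := 0) h.pos₂ h2 h0).2⟩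
    · exact ⟨(hz (P' := 0) h.pos₂ h5 h0).1, .inr (hz (P' := 0) h.pos₂ h5 h0).2⟩
  have hr' : w = 0 ∧ (R = 0 ∨ R' = 0) := by
    rcases hr with h0 | h0
    · exact ⟨(hz (P' := 0) h.pos₃ h3 h0).1, .inl (hz (P' := 0) h.pos₃ h3 h0).2⟩
    · exact ⟨(hz (P' := 0) h.pos₃ h6 h0).1, .inr (hz (P' := 0) h.pos₃ h6 h0).2⟩
  rw [hp'.1, zero_add] at h1 h4
  rw [hq'.1, zero_add] at h2 h5
  rw [hr'.1, zero_add] at h3 h6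
  exact ⟨P, Q, R, P', Q', R', h1, h2, h3, h4, h5, h6, h7, hp'.2, hq'.2, hr'.2⟩

end IsArranged

/-- The exponents of `x₁^{d₁} - x₂^{d₂}` and of the `x₃^{d₃} - x₁^{k d₁} x₂^{l d₂}`, `k + l = f`. -/
def IsListedPair (σ : Equiv.Perm (Fin 3)) (d₁ d₂ d₃ f : ℕ) (u v : Fin 3 →₀ ℕ) : Prop :=
  (u = expo σ d₁ 0 0 ∧ v = expo σ 0 d₂ 0) ∨
    ∃ k l, k + l = f ∧ u = expo σ 0 0 d₃ ∧ v = expo σ (k * d₁) (l * d₂) 0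

/-- The exponents of the three binomials in two variables. -/
def IsTwoVariablePair (σ : Equiv.Perm (Fin 3)) (d₁ d₂ d₃ f : ℕ) (u v : Fin 3 →₀ ℕ) : Prop :=
  (u = expo σ d₁ 0 0 ∧ v = expo σ 0 d₂ 0) ∨
    (u = expo σ (f * d₁) 0 0 ∧ v = expo σ 0 0 d₃) ∨
    (u = expo σ 0 (f * d₂) 0 ∧ v = expo σ 0 0 d₃)

/-- Dividing both monomials by a common variable would give a smaller binomial of the ideal. -/
theorem IsPrimitivePair.eq_zero_or_eq_zero {n : ℕ} {a : Fin n → ℕ} {u v : Fin n →₀ ℕ}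
    (h : IsPrimitivePair a u v) (i : Fin n) : u i = 0 ∨ v i = 0 := by
  by_contra! hcon
  have hu : Finsupp.single i 1 ≤ u := by
    rw [Finsupp.single_le_iff]
    omega
  have hv : Finsupp.single i 1 ≤ v := by
    rw [Finsupp.single_le_iff]
    omega
  obtain ⟨w, rfl⟩ := exists_add_of_le hu
  obtain ⟨z, rfl⟩ := exists_add_of_le hv
  have hd := h.2.1
  rw [aDegree_add, aDegree_add] at hd
  have := (h.2.2 w z (fun hwz => h.1 (by rw [hwz])) (by omega) le_add_self le_add_self).1
  have := DFunLike.congr_fun this i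
  simp at this

namespace IsArranged

theorem aDegree_eq_of_isListedPair (h : IsArranged a σ d₁ d₂ d₃ f) {u v : Fin 3 →₀ ℕ}
    (hl : IsListedPair σ d₁ d₂ d₃ f u v) : aDegree a u = aDegree a v := by
  rcases hl with ⟨rfl, rfl⟩ | ⟨k, l, rfl, rfl, rfl⟩
  · rw [aDegree_expo, aDegree_expo, h.eq₁, h.eq₂]
    ring
  · rw [aDegree_expo, aDegree_expo, h.eq₁, h.eq₂, h.eq₃]
    ring

/-- In the weights (1, 1, f), every nontrivial relation with disjoint supports dominates a listed
one, and primitivity turns domination into equality. If P and Q' or P' and Q are positive, it is the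
relation between x₁ and x₂; if R or R' is positive, the other side has enough weight to split off k
+ l = f. -/
theorem isListedPair_of_isPrimitivePair (h : IsArranged a σ d₁ d₂ d₃ f) {u v : Fin 3 →₀ ℕ}
    (hp : IsPrimitivePair a u v) :
    IsListedPair σ d₁ d₂ d₃ f u v ∨ IsListedPair σ d₁ d₂ d₃ f v u := by
  obtain ⟨p, q, r, rfl⟩ := exists_eq_expo σ u
  obtain ⟨p', q', r', rfl⟩ := exists_eq_expo σ v
  have hp0 := hp.eq_zero_or_eq_zero (σ 0)
  have hq0 := hp.eq_zero_or_eq_zero (σ 1)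
  have hr0 := hp.eq_zero_or_eq_zero (σ 2)
  simp only [expo_apply_zero, expo_apply_one, expo_apply_two] at hp0 hq0 hr0
  obtain ⟨P, Q, R, P', Q', R', rfl, rfl, rfl, rfl, rfl, rfl, heq, hP, hQ, hR⟩ :=
    h.exists_of_disjoint hp.2.1 hp0 hq0 hr0
  have hle : ∀ {d x : ℕ}, 0 < x → d ≤ d * x := fun hx => Nat.le_mul_of_pos_right _ hx
  have hl1 : IsListedPair σ d₁ d₂ d₃ f (expo σ d₁ 0 0) (expo σ 0 d₂ 0) := .inl ⟨rfl, rfl⟩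
  have hl2 : ∀ k l, k + l = f → IsListedPair σ d₁ d₂ d₃ f (expo σ 0 0 d₃)
      (expo σ (k * d₁) (l * d₂) 0) := fun k l hkl => .inr ⟨k, l, hkl, rfl, rfl⟩
  have hne : ∀ {u v}, IsListedPair σ d₁ d₂ d₃ f u v → u ≠ v := by
    have h1 := h.pos₁
    have h3 := h.pos₃
    rintro u v (⟨rfl, rfl⟩ | ⟨k, l, -, rfl, rfl⟩) he
    · rw [expo_inj] at he
      omega
    · rw [expo_inj] at he
      omega
  have case1 : ∀ {w z}, IsListedPair σ d₁ d₂ d₃ f w z →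
      w ≤ expo σ (d₁ * P) (d₂ * Q) (d₃ * R) → z ≤ expo σ (d₁ * P') (d₂ * Q') (d₃ * R') →
      IsListedPair σ d₁ d₂ d₃ f (expo σ (d₁ * P) (d₂ * Q) (d₃ * R))
        (expo σ (d₁ * P') (d₂ * Q') (d₃ * R')) := by
    intro w z hwz hw hz
    obtain ⟨h1, h2⟩ := hp.2.2 w z (hne hwz) (h.aDegree_eq_of_isListedPair hwz) hw hz
    rwa [← h1, ← h2]
  have case2 : ∀ {w z}, IsListedPair σ d₁ d₂ d₃ f w z →
      z ≤ expo σ (d₁ * P) (d₂ * Q) (d₃ * R) → w ≤ expo σ (d₁ * P') (d₂ * Q') (d₃ * R') →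
      IsListedPair σ d₁ d₂ d₃ f (expo σ (d₁ * P') (d₂ * Q') (d₃ * R'))
        (expo σ (d₁ * P) (d₂ * Q) (d₃ * R)) := by
    intro w z hwz hz hw
    obtain ⟨h1, h2⟩ := hp.2.2 z w (hne hwz).symm (h.aDegree_eq_of_isListedPair hwz).symm hz hw
    rwa [← h1, ← h2]
  by_cases c1 : 0 < P ∧ 0 < Q'
  · refine .inl (case1 hl1 ?_ ?_) <;> rw [expo_le_iff]
    · exact ⟨hle c1.1, Nat.zero_le _, Nat.zero_le _⟩
    · exact ⟨Nat.zero_le _, hle c1.2, Nat.zero_le _⟩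
  by_cases c2 : 0 < P' ∧ 0 < Q
  · refine .inr (case2 hl1 ?_ ?_) <;> rw [expo_le_iff]
    · exact ⟨Nat.zero_le _, hle c2.2, Nat.zero_le _⟩
    · exact ⟨hle c2.1, Nat.zero_le _, Nat.zero_le _⟩
  have split : ∀ {x y R : ℕ}, 0 < R → f * R ≤ x + y → ∃ k l, k + l = f ∧ k ≤ x ∧ l ≤ y := by
    intro x y R hR hxy
    have := hle (d := f) hR
    -- Take as much of `f` as possible from `x`; the rest fits into `y`, since `f ≤ f * R ≤ x + y`.
    exact ⟨min x f, f - min x f, by omega, by omega, by omega⟩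
  by_cases c3 : 0 < R
  · have hR' : R' = 0 := by omega
    have hfR : 0 < f * R := Nat.mul_pos h.pos_f c3
    subst hR'
    rw [mul_zero] at heq
    obtain ⟨k, l, hkl, hk, hl⟩ := split (x := P') (y := Q') c3 (by omega)
    refine .inl (case1 (hl2 k l hkl) ?_ ?_) <;> rw [expo_le_iff]
    · exact ⟨Nat.zero_le _, Nat.zero_le _, hle c3⟩
    · exact ⟨by rw [mul_comm]; gcongr, by rw [mul_comm]; gcongr, Nat.zero_le _⟩
  by_cases c4 : 0 < R'
  · have hR' : R = 0 := by omega
    have hfR : 0 < f * R' := Nat.mul_pos h.pos_f c4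
    subst hR'
    rw [mul_zero] at heq
    obtain ⟨k, l, hkl, hk, hl⟩ := split (x := P) (y := Q) c4 (by omega)
    refine .inr (case2 (hl2 k l hkl) ?_ ?_) <;> rw [expo_le_iff]
    · exact ⟨by rw [mul_comm]; gcongr, by rw [mul_comm]; gcongr, Nat.zero_le _⟩
    · exact ⟨Nat.zero_le _, Nat.zero_le _, hle c4⟩
  -- Now R = R' = 0, and the first two variables never occur on opposite sides, so equal weights
  -- make the two monomials equal.
  exfalso
  refine hp.1 ?_
  have hR1 : R = 0 := by omega
  have hR2 : R' = 0 := by omega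
  subst hR1 hR2
  have : P = P' ∧ Q = Q' := by omega
  rw [this.1, this.2]

theorem isCritical_zero (h : IsArranged a σ d₁ d₂ d₃ f) : IsCritical a (σ 0) d₁ := by
  constructor
  · refine ⟨h.pos₁, mem_closure_image_iff.2 ⟨expo σ 0 d₂ 0, by simp, ?_⟩⟩
    rw [aDegree_expo, h.eq₁, h.eq₂]
    ring
  · rintro c ⟨hc, hmem⟩
    obtain ⟨u, hu, hd⟩ := mem_closure_image_iff.1 hmem
    obtain ⟨p, q, r, rfl⟩ := exists_eq_expo σ u
    have hp : p = 0 := by simpa using hu (σ 0) (by simp)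
    rw [← aDegree_single, single_zero_eq_expo] at hd
    obtain ⟨P, -, -, -, -, -, rfl, -⟩ := h.exists_of_disjoint hd (.inr hp) (.inl rfl) (.inl rfl)
    exact Nat.le_of_dvd hc (dvd_mul_right _ _)

theorem isCritical_two (h : IsArranged a σ d₁ d₂ d₃ f) : IsCritical a (σ 2) d₃ := by
  constructor
  · refine ⟨h.pos₃, mem_closure_image_iff.2 ⟨expo σ 0 (f * d₂) 0, by simp, ?_⟩⟩
    rw [aDegree_expo, h.eq₃, h.eq₂]
    ring
  · rintro c ⟨hc, hmem⟩
    obtain ⟨u, hu, hd⟩ := mem_closure_image_iff.1 hmem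
    obtain ⟨p, q, r, rfl⟩ := exists_eq_expo σ u
    have hr : r = 0 := by simpa using hu (σ 2) (by simp)
    rw [← aDegree_single, single_two_eq_expo] at hd
    obtain ⟨-, -, R, -, -, -, -, -, rfl, -⟩ :=
      h.exists_of_disjoint hd (.inl rfl) (.inl rfl) (.inr hr)
    exact Nat.le_of_dvd hc (dvd_mul_right _ _)

theorem binom_mem_criticalBinomials (h : IsArranged a σ d₁ d₂ d₃ f) {u v : Fin 3 →₀ ℕ}
    (hl : IsListedPair σ d₁ d₂ d₃ f u v) : binom K u v ∈ criticalBinomials K a := by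
  have hd := h.aDegree_eq_of_isListedPair hl
  rcases hl with ⟨rfl, rfl⟩ | ⟨k, l, hkl, rfl, rfl⟩
  · refine ⟨σ 0, d₁, expo σ 0 d₂ 0, h.isCritical_zero, by simp, ?_, by rw [single_zero_eq_expo]⟩
    rw [← hd, ← single_zero_eq_expo, aDegree_single]
  · refine ⟨σ 2, d₃, expo σ (k * d₁) (l * d₂) 0, h.isCritical_two, by simp, ?_,
      by rw [single_two_eq_expo]⟩
    rw [← hd, ← single_two_eq_expo, aDegree_single]

/-! ### Two-element Markov bases and Betti degrees. -/

theorem span_pair_eq_toricIdeal (h : IsArranged a σ d₁ d₂ d₃ f) {k l : ℕ} (hkl : k + l = f) :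
    Ideal.span {binom K (expo σ d₁ 0 0) (expo σ 0 d₂ 0),
      binom K (expo σ 0 0 d₃) (expo σ (k * d₁) (l * d₂) 0)} = toricIdeal K a := by
  refine le_antisymm (Ideal.span_le.2 ?_) (Ideal.span_le.2 ?_)
  · rintro _ (rfl | rfl)
    · exact binom_mem_of_aDegree_eq (h.aDegree_eq_of_isListedPair (.inl ⟨rfl, rfl⟩))
    · exact binom_mem_of_aDegree_eq
        (h.aDegree_eq_of_isListedPair (.inr ⟨k, l, hkl, rfl, rfl⟩))
  · rintro _ ⟨u, v, huv, rfl⟩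
    obtain ⟨p, q, r, rfl⟩ := exists_eq_expo σ u
    obtain ⟨p', q', r', rfl⟩ := exists_eq_expo σ v
    set J : Ideal (MvPolynomial (Fin 3) K) :=
      Ideal.span {binom K (expo σ d₁ 0 0) (expo σ 0 d₂ 0),
        binom K (expo σ 0 0 d₃) (expo σ (k * d₁) (l * d₂) 0)} with hJ
    have e1 : binom K (expo σ d₁ 0 0) (expo σ 0 d₂ 0) ∈ J := Ideal.subset_span (by simp)
    have e2 : binom K (expo σ 0 0 d₃) (expo σ (k * d₁) (l * d₂) 0) ∈ J :=
      Ideal.subset_span (by simp)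
    simp only [SetLike.mem_coe, binom, ← Ideal.Quotient.eq, monomial_expo, map_mul, map_pow,
      pow_zero, mul_one, one_mul] at e1 e2 ⊢
    set x := Ideal.Quotient.mk J (X (σ 0))
    set y := Ideal.Quotient.mk J (X (σ 1))
    set z := Ideal.Quotient.mk J (X (σ 2))
    have e3 : z ^ d₃ = (x ^ d₁) ^ f := by
      rw [e2, mul_comm k, mul_comm l, pow_mul, pow_mul, ← e1, ← pow_add, hkl]
    obtain ⟨s, t, w, P, Q, R, P', Q', R', rfl, rfl, rfl, rfl, rfl, rfl, heq⟩ :=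
      h.exists_of_aDegree_eq huv
    -- In the quotient x^{d₁} = y^{d₂} and z^{d₃} = (x^{d₁})^f, so a monomial depends only on its
    -- remainders and on P + Q + fR.
    have key : ∀ P Q R, x ^ (s + d₁ * P) * y ^ (t + d₂ * Q) * z ^ (w + d₃ * R) =
        x ^ s * y ^ t * z ^ w * (x ^ d₁) ^ (P + Q + f * R) := by
      intro P Q R
      rw [pow_add, pow_add, pow_add, pow_mul x, pow_mul y, pow_mul z, e3, ← e1, pow_add, pow_add,
        ← pow_mul (x ^ d₁) f]
      ring
    rw [key, key, heq]

/-- The principal ideal lies in the monomial ideal (x^u, x^v), every element of which has all its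
monomials divisible by x^u or x^v. -/
theorem not_mem_span_singleton {n : ℕ} {u v w z : Fin n →₀ ℕ} (hne : w ≠ z) (hu : ¬ u ≤ w)
    (hv : ¬ v ≤ w) : binom K w z ∉ Ideal.span {binom K u v} := by
  classical
  intro h
  have hle : Ideal.span {binom K u v} ≤
      Ideal.span ((fun s => monomial s (1 : K)) '' ({u, v} : Set (Fin n →₀ ℕ))) := by
    rw [Ideal.span_singleton_le_iff_mem]
    exact Ideal.sub_mem _ (Ideal.subset_span ⟨u, by simp, rfl⟩)
      (Ideal.subset_span ⟨v, by simp, rfl⟩)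
  have h1 := hle h
  rw [mem_ideal_span_monomial_image] at h1
  obtain ⟨s, hs, hs'⟩ := h1 w (by simp [support_binom hne])
  rcases hs with rfl | rfl
  · exact hu hs'
  · exact hv hs'

theorem isMarkovBasis_pair (h : IsArranged a σ d₁ d₂ d₃ f) {k l : ℕ} (hkl : k + l = f) :
    IsMarkovBasis K a {binom K (expo σ d₁ 0 0) (expo σ 0 d₂ 0),
      binom K (expo σ 0 0 d₃) (expo σ (k * d₁) (l * d₂) 0)} := by
  have h1 := h.pos₁
  have h2 := h.pos₂
  have h3 := h.pos₃
  have h4 := h.pos_f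
  refine ⟨?_, h.span_pair_eq_toricIdeal hkl, fun N hN hspan => ?_⟩
  · rintro _ (rfl | rfl) <;> exact ⟨_, _, rfl⟩
  · rw [← h.span_pair_eq_toricIdeal (K := K) hkl] at hspan
    set g₁ := binom K (expo σ d₁ 0 0) (expo σ 0 d₂ 0) with hg₁
    set g₂ := binom K (expo σ 0 0 d₃) (expo σ (k * d₁) (l * d₂) 0) with hg₂
    have m1 : g₁ ∉ Ideal.span {g₂} := by
      -- When l = 0 and f = 1, the term x₁^{kd₁} of g₂ divides x₁^{d₁}. For l = 0 the test monomial
      -- is therefore x₂^{d₂}, reached by changing sign.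
      rcases Nat.eq_zero_or_pos l with hl | hl
      · rw [hg₁, ← neg_mem_iff, neg_binom]
        refine not_mem_span_singleton ?_ ?_ ?_
        · rw [Ne, expo_inj]
          omega
        · rw [expo_le_iff]
          omega
        · have : 0 < k * d₁ := Nat.mul_pos (by omega) h1
          rw [expo_le_iff]
          omega
      · have : 0 < l * d₂ := Nat.mul_pos (by omega) h2
        refine not_mem_span_singleton ?_ ?_ ?_
        · rw [Ne, expo_inj]
          omega
        · rw [expo_le_iff]
          omega
        · rw [expo_le_iff]
          omega
    have m2 : g₂ ∉ Ideal.span {g₁} := by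
      refine not_mem_span_singleton ?_ ?_ ?_
      · rw [Ne, expo_inj]
        omega
      · rw [expo_le_iff]
        omega
      · rw [expo_le_iff]
        omega
    by_cases c1 : g₁ ∈ N
    · have c2 : g₂ ∉ N := fun c2 => hN.2 (by rintro _ (rfl | rfl) <;> assumption)
      have hsub : N ⊆ {g₁} := fun x hx => by
        rcases hN.1 hx with rfl | rfl
        · rfl
        · exact absurd hx c2
      exact m2 (Ideal.span_mono hsub (hspan ▸ Ideal.subset_span (by simp)))
    · have hsub : N ⊆ {g₂} := fun x hx => by
        rcases hN.1 hx with rfl | rfl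
        · exact absurd hx c1
        · rfl
      exact m1 (Ideal.span_mono hsub (hspan ▸ Ideal.subset_span (by simp)))

theorem exists_isMarkovBasis_of_isListedPair (h : IsArranged a σ d₁ d₂ d₃ f) {u v : Fin 3 →₀ ℕ}
    (hl : IsListedPair σ d₁ d₂ d₃ f u v) : ∃ M, IsMarkovBasis K a M ∧ binom K u v ∈ M := by
  rcases hl with ⟨rfl, rfl⟩ | ⟨k, l, hkl, rfl, rfl⟩
  · exact ⟨_, h.isMarkovBasis_pair (k := 0) (l := f) (by simp), by simp⟩
  · exact ⟨_, h.isMarkovBasis_pair hkl, by simp⟩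

theorem bettiDegrees_eq (h : IsArranged a σ d₁ d₂ d₃ f) :
    bettiDegrees K a = {d₁ * d₂ * d₃, f * d₁ * d₂ * d₃} := by
  have hdeg : ∀ u v, IsListedPair σ d₁ d₂ d₃ f u v →
      aDegree a u = d₁ * d₂ * d₃ ∨ aDegree a u = f * d₁ * d₂ * d₃ := by
    rintro u v (⟨rfl, rfl⟩ | ⟨k, l, hkl, rfl, rfl⟩)
    · refine .inl ?_
      rw [aDegree_expo, h.eq₁]
      ring
    · refine .inr ?_
      rw [aDegree_expo, h.eq₃]
      ring
  ext b
  simp only [Set.mem_insert_iff, Set.mem_singleton_iff]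
  constructor
  · rintro ⟨M, hM, u, v, hmem, rfl, hv⟩
    obtain ⟨u', v', he, hp⟩ := mem_graverBasis_iff.1
      (universalMarkovBasis_subset_graverBasis h.pos ⟨M, hM, hmem⟩)
    have huv : aDegree a u = aDegree a u' := by
      rcases eq_or_eq_of_binom_eq hp.1 he.symm with ⟨rfl, rfl⟩ | ⟨rfl, rfl⟩
      · rfl
      · exact hv.symm
    rw [huv]
    rcases h.isListedPair_of_isPrimitivePair hp with hl | hl
    · exact hdeg _ _ hl
    · rw [hp.2.1]
      exact hdeg _ _ hl
  · rintro (rfl | rfl)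
    · have hl : IsListedPair σ d₁ d₂ d₃ f (expo σ d₁ 0 0) (expo σ 0 d₂ 0) := .inl ⟨rfl, rfl⟩
      obtain ⟨M, hM, hmem⟩ := h.exists_isMarkovBasis_of_isListedPair (K := K) hl
      refine ⟨M, hM, _, _, hmem, ?_, ?_⟩
      · rw [aDegree_expo, h.eq₁]
        ring
      · rw [aDegree_expo, h.eq₂]
        ring
    · have hl : IsListedPair σ d₁ d₂ d₃ f (expo σ 0 0 d₃) (expo σ (0 * d₁) (f * d₂) 0) :=
        .inr ⟨0, f, by simp, rfl, rfl⟩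
      obtain ⟨M, hM, hmem⟩ := h.exists_isMarkovBasis_of_isListedPair (K := K) hl
      refine ⟨M, hM, _, _, hmem, ?_, ?_⟩
      · rw [aDegree_expo, h.eq₃]
        ring
      · rw [aDegree_expo, h.eq₂]
        ring

end IsArranged

end ThreeVariables

/-! ### The Graver, critical, Markov and Gröbner sets up to sign. -/

section Bases

variable {K : Type*} [Field K] {σ : Equiv.Perm (Fin 3)} {a : Fin 3 → ℕ} {d₁ d₂ d₃ f : ℕ}

/-- The binomials `x^u - x^v` with `R u v`. -/
def binomSet (K : Type*) [Field K] {n : ℕ} (R : (Fin n →₀ ℕ) → (Fin n →₀ ℕ) → Prop) :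
    Set (MvPolynomial (Fin n) K) :=
  {g | ∃ u v, R u v ∧ g = binom K u v}

theorem upToSign_pair_eq {n : ℕ} {u v u' v' : Fin n →₀ ℕ} (h : u ≠ v)
    (he : ({binom K u v, -binom K u v} : Set (MvPolynomial (Fin n) K)) =
      {binom K u' v', -binom K u' v'}) : (u' = u ∧ v' = v) ∨ (u' = v ∧ v' = u) := by
  have : binom K u v ∈ ({binom K u' v', -binom K u' v'} : Set (MvPolynomial (Fin n) K)) :=
    he ▸ by simp
  rcases this with h1 | h1
  · exact eq_or_eq_of_binom_eq h h1
  · rw [Set.mem_singleton_iff, neg_binom] at h1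
    rcases eq_or_eq_of_binom_eq h h1 with ⟨rfl, rfl⟩ | ⟨rfl, rfl⟩ <;> simp

namespace IsArranged

theorem upToSign_graverBasis_subset (h : IsArranged a σ d₁ d₂ d₃ f) :
    upToSign (graverBasis K a) ⊆ upToSign (binomSet K (IsListedPair σ d₁ d₂ d₃ f)) := by
  refine upToSign_subset fun g hg => ?_
  obtain ⟨u, v, rfl, hp⟩ := mem_graverBasis_iff.1 hg
  rcases h.isListedPair_of_isPrimitivePair hp with hl | hl
  · exact .inl ⟨u, v, hl, rfl⟩
  · exact .inr ⟨v, u, hl, neg_binom _ _⟩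

theorem upToSign_graverBasis (h : IsArranged a σ d₁ d₂ d₃ f) :
    upToSign (graverBasis K a) = upToSign (binomSet K (IsListedPair σ d₁ d₂ d₃ f)) := by
  refine h.upToSign_graverBasis_subset.antisymm (Set.image_mono ?_)
  rintro _ ⟨u, v, hl, rfl⟩
  exact criticalBinomials_subset_graverBasis h.pos (h.binom_mem_criticalBinomials hl)

theorem upToSign_criticalBinomials (h : IsArranged a σ d₁ d₂ d₃ f) :
    upToSign (criticalBinomials K a) = upToSign (binomSet K (IsListedPair σ d₁ d₂ d₃ f)) := by
  refine ((Set.image_mono (criticalBinomials_subset_graverBasis h.pos)).trans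
    h.upToSign_graverBasis_subset).antisymm (Set.image_mono ?_)
  rintro _ ⟨u, v, hl, rfl⟩
  exact h.binom_mem_criticalBinomials hl

theorem upToSign_universalMarkovBasis (h : IsArranged a σ d₁ d₂ d₃ f) :
    upToSign (universalMarkovBasis K a) =
      upToSign (binomSet K (IsListedPair σ d₁ d₂ d₃ f)) := by
  refine ((Set.image_mono (universalMarkovBasis_subset_graverBasis h.pos)).trans
    h.upToSign_graverBasis_subset).antisymm (Set.image_mono ?_)
  rintro _ ⟨u, v, hl, rfl⟩
  exact h.exists_isMarkovBasis_of_isListedPair hl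

theorem isTwoVariablePair_of_isReducedPair (h : IsArranged a σ d₁ d₂ d₃ f)
    {m : MonomialOrder (Fin 3)} {u v : Fin 3 →₀ ℕ} (hr : IsReducedPair m a u v) :
    IsTwoVariablePair σ d₁ d₂ d₃ f u v ∨ IsTwoVariablePair σ d₁ d₂ d₃ f v u := by
  have hd : aDegree a (expo σ d₁ 0 0) = aDegree a (expo σ 0 d₂ 0) :=
    h.aDegree_eq_of_isListedPair (.inl ⟨rfl, rfl⟩)
  have h1 := h.pos₁
  have h2 := h.pos₂
  -- x₁^{d₁} and x₂^{d₂} properly divide the mixed monomial, so they would be two distinct minima of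
  -- the same fibre.
  have hmixed : ∀ k l, 0 < k → 0 < l → (∀ w ≤ expo σ (k * d₁) (l * d₂) 0,
      w ≠ expo σ (k * d₁) (l * d₂) 0 → IsFiberMin m a w) → False := by
    intro k l hk hl hw
    have hk' : d₁ ≤ k * d₁ := Nat.le_mul_of_pos_left _ hk
    have hl' : d₂ ≤ l * d₂ := Nat.le_mul_of_pos_left _ hl
    have m1 := hw (expo σ d₁ 0 0) (by rw [expo_le_iff]; omega) (by rw [Ne, expo_inj]; omega)
    have m2 := hw (expo σ 0 d₂ 0) (by rw [expo_le_iff]; omega) (by rw [Ne, expo_inj]; omega)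
    have := m1.eq m2 hd
    rw [expo_inj] at this
    omega
  rcases h.isListedPair_of_isPrimitivePair (hr.isPrimitivePair h.pos) with
    (hl | ⟨k, l, hkl, hu, hv⟩) | (hl | ⟨k, l, hkl, hv, hu⟩)
  · exact .inl (.inl hl)
  · right
    rcases Nat.eq_zero_or_pos k with rfl | hk
    · refine .inr (.inr ⟨?_, hu⟩)
      rw [hv, ← hkl]
      simp
    rcases Nat.eq_zero_or_pos l with rfl | hl
    · refine .inr (.inl ⟨?_, hu⟩)
      rw [hv, ← hkl]
      simp
    · exact (hmixed k l hk hl fun w hw _ => hr.2.2.1.of_le (hv ▸ hw)).elim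
  · exact .inr (.inl hl)
  · left
    rcases Nat.eq_zero_or_pos k with rfl | hk
    · refine .inr (.inr ⟨?_, hv⟩)
      rw [hu, ← hkl]
      simp
    rcases Nat.eq_zero_or_pos l with rfl | hl
    · refine .inr (.inl ⟨?_, hv⟩)
      rw [hu, ← hkl]
      simp
    · exact (hmixed k l hk hl (hu ▸ hr.2.2.2)).elim

theorem aDegree_eq_of_isTwoVariablePair (h : IsArranged a σ d₁ d₂ d₃ f) {u v : Fin 3 →₀ ℕ}
    (hl : IsTwoVariablePair σ d₁ d₂ d₃ f u v) : aDegree a u = aDegree a v := by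
  rcases hl with ⟨rfl, rfl⟩ | ⟨rfl, rfl⟩ | ⟨rfl, rfl⟩ <;>
  · simp only [aDegree_expo, h.eq₁, h.eq₂, h.eq₃]
    ring

end IsArranged

/-- Choose an order in which powers of xⱼ are smallest in their fibres. Proper divisors of xᵢ^c are
alone in their fibres because `c` is critical, so the pair is reduced. -/
theorem IsCritical.binom_mem_universalGroebnerBasis {n : ℕ} {a : Fin n → ℕ}
    (ha : ∀ i, 0 < a i) {i j : Fin n} (hij : i ≠ j) {c c' : ℕ} (hc : IsCritical a i c)
    (hd : c * a i = c' * a j) :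
    binom K (Finsupp.single i c) (Finsupp.single j c') ∈ universalGroebnerBasis K a := by
  obtain ⟨m, hm⟩ := exists_isFiberMin_single ha j
  refine mem_universalGroebnerBasis_iff.2 ⟨m, _, _, rfl, ?_, ?_, hm c', fun w hw hne => ?_⟩
  · rw [Ne, Finsupp.single_eq_single_iff]
    have := hc.1.1
    omega
  · rw [aDegree_single, aDegree_single, hd]
  · have hw' : w = Finsupp.single i (w i) := by
      ext t
      by_cases ht : t = i
      · simp [ht]
      · have := hw t
        rw [Finsupp.single_apply, if_neg (Ne.symm ht)] at this ⊢
        omega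
    intro z hz
    by_contra hcon
    have hwz : w ≠ z := by
      rintro rfl
      exact hcon le_rfl
    have hle : c ≤ w i := by
      refine hc.le_of_aDegree_eq (r := z) (by rwa [← hw']) ha ?_
      rw [← aDegree_single, ← hw', hz]
    have hwi := hw i
    rw [Finsupp.single_eq_same] at hwi
    exact hne (by rw [hw', show w i = c by omega])

namespace IsArranged

theorem upToSign_universalGroebnerBasis (h : IsArranged a σ d₁ d₂ d₃ f) :
    upToSign (universalGroebnerBasis K a) =
      upToSign (binomSet K (IsTwoVariablePair σ d₁ d₂ d₃ f)) := by
  refine (upToSign_subset fun g hg => ?_).antisymm (upToSign_subset fun g hg => ?_)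
  · obtain ⟨m, u, v, rfl, hr⟩ := mem_universalGroebnerBasis_iff.1 hg
    rcases h.isTwoVariablePair_of_isReducedPair hr with hl | hl
    · exact .inl ⟨u, v, hl, rfl⟩
    · exact .inr ⟨v, u, hl, neg_binom _ _⟩
  · obtain ⟨u, v, hl, rfl⟩ := hg
    have hd := h.aDegree_eq_of_isTwoVariablePair hl
    rw [neg_binom]
    rcases hl with ⟨rfl, rfl⟩ | ⟨rfl, rfl⟩ | ⟨rfl, rfl⟩
    · left
      rw [← single_zero_eq_expo, ← single_one_eq_expo] at hd ⊢
      rw [aDegree_single, aDegree_single] at hd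
      exact h.isCritical_zero.binom_mem_universalGroebnerBasis h.pos (by simp) hd
    -- Here x₃^{d₃} is the critical power, so it must be the leading term: the binomial is found
    -- with the opposite sign.
    · right
      rw [← single_zero_eq_expo, ← single_two_eq_expo] at hd ⊢
      rw [aDegree_single, aDegree_single] at hd
      exact h.isCritical_two.binom_mem_universalGroebnerBasis h.pos (by simp) hd.symm
    · right
      rw [← single_one_eq_expo, ← single_two_eq_expo] at hd ⊢
      rw [aDegree_single, aDegree_single] at hd
      exact h.isCritical_two.binom_mem_universalGroebnerBasis h.pos (by simp) hd.symm

end IsArranged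

/-! ### Circuits, and the cardinalities of the sets. -/

theorem expo_support_union_ssubset_iff {p q r p' q' r' s t w s' t' w' : ℕ} :
    (expo σ p q r).support ∪ (expo σ p' q' r').support ⊂
        (expo σ s t w).support ∪ (expo σ s' t' w').support ↔
      ((p ≠ 0 ∨ p' ≠ 0 → s ≠ 0 ∨ s' ≠ 0) ∧ (q ≠ 0 ∨ q' ≠ 0 → t ≠ 0 ∨ t' ≠ 0) ∧
        (r ≠ 0 ∨ r' ≠ 0 → w ≠ 0 ∨ w' ≠ 0)) ∧
      ¬ ((s ≠ 0 ∨ s' ≠ 0 → p ≠ 0 ∨ p' ≠ 0) ∧ (t ≠ 0 ∨ t' ≠ 0 → q ≠ 0 ∨ q' ≠ 0) ∧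
        (w ≠ 0 ∨ w' ≠ 0 → r ≠ 0 ∨ r' ≠ 0)) := by
  rw [Finset.ssubset_def, Finset.subset_iff, Finset.subset_iff, forall_perm_fin_three σ,
    forall_perm_fin_three σ]
  simp only [Finset.mem_union, Finsupp.mem_support_iff, expo_apply_zero, expo_apply_one,
    expo_apply_two]

theorem expo_disjoint_support_iff {p q r p' q' r' : ℕ} :
    Disjoint (expo σ p q r).support (expo σ p' q' r').support ↔
      (p = 0 ∨ p' = 0) ∧ (q = 0 ∨ q' = 0) ∧ (r = 0 ∨ r' = 0) := by
  rw [Finset.disjoint_left, forall_perm_fin_three σ]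
  simp only [Finsupp.mem_support_iff, expo_apply_zero, expo_apply_one, expo_apply_two]
  omega

theorem dvd_univ_gcd_expo_iff {p q r g : ℕ} :
    g ∣ Finset.univ.gcd (⇑(expo σ p q r)) ↔ g ∣ p ∧ g ∣ q ∧ g ∣ r := by
  rw [Finset.dvd_gcd_iff]
  simp only [Finset.mem_univ, true_imp_iff]
  rw [forall_perm_fin_three σ]
  simp

namespace IsArranged

theorem ne_of_isTwoVariablePair (h : IsArranged a σ d₁ d₂ d₃ f) {u v : Fin 3 →₀ ℕ}
    (hl : IsTwoVariablePair σ d₁ d₂ d₃ f u v) : u ≠ v := by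
  have h1 := h.pos₁
  have h3 := h.pos₃
  rcases hl with ⟨rfl, rfl⟩ | ⟨rfl, rfl⟩ | ⟨rfl, rfl⟩ <;>
  · rw [Ne, expo_inj]
    omega

/-- The binomial x₁^{d₁} - x₂^{d₂} rules out circuits involving all three variables. On two
variables the relation is a multiple of a single one, and coprime exponents make the multiplier 1.
-/
theorem isTwoVariablePair_of_isCircuit (h : IsArranged a σ d₁ d₂ d₃ f) {u v : Fin 3 →₀ ℕ}
    (hd : aDegree a u = aDegree a v) (hdisj : Disjoint u.support v.support)
    (hgcd : Finset.univ.gcd (⇑(u + v)) = 1)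
    (hmin : ∀ u' v', u' ≠ v' → aDegree a u' = aDegree a v' →
      ¬ (u'.support ∪ v'.support ⊂ u.support ∪ v.support)) :
    IsTwoVariablePair σ d₁ d₂ d₃ f u v ∨ IsTwoVariablePair σ d₁ d₂ d₃ f v u := by
  obtain ⟨p, q, r, rfl⟩ := exists_eq_expo σ u
  obtain ⟨p', q', r', rfl⟩ := exists_eq_expo σ v
  rw [expo_disjoint_support_iff] at hdisj
  obtain ⟨P, Q, R, P', Q', R', rfl, rfl, rfl, rfl, rfl, rfl, heq, hP, hQ, hR⟩ :=
    h.exists_of_disjoint hd hdisj.1 hdisj.2.1 hdisj.2.2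
  have h1 := h.pos₁
  have h2 := h.pos₂
  have h3 := h.pos₃
  have h4 := h.pos_f
  have g1 : ∀ g, g ∣ P + P' → g ∣ Q + Q' → g ∣ R + R' → g = 1 := by
    intro g e1 e2 e3
    rw [← Nat.dvd_one, ← hgcd, expo_add, dvd_univ_gcd_expo_iff, ← mul_add, ← mul_add, ← mul_add]
    exact ⟨dvd_mul_of_dvd_right e1 _, dvd_mul_of_dvd_right e2 _, dvd_mul_of_dvd_right e3 _⟩
  have hpair : IsTwoVariablePair σ d₁ d₂ d₃ f (expo σ d₁ 0 0) (expo σ 0 d₂ 0) := .inl ⟨rfl, rfl⟩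
  have hno := hmin _ _ (h.ne_of_isTwoVariablePair hpair) (h.aDegree_eq_of_isTwoVariablePair hpair)
  rw [expo_support_union_ssubset_iff] at hno
  simp only [ne_eq, Nat.mul_eq_zero, h1.ne', h2.ne', h3.ne', false_or] at hno
  by_cases cR : R = 0 ∧ R' = 0
  · obtain ⟨rfl, rfl⟩ := cR
    simp only [mul_zero, add_zero] at heq g1 ⊢
    by_cases cP : P' = 0
    · have hQ : Q = 0 ∧ P = Q' := by omega
      obtain ⟨rfl, rfl⟩ := hQ
      have := g1 P (by simp [cP]) (by simp) (by simp)
      subst this cP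
      exact .inl (.inl ⟨by simp, by simp⟩)
    · have hQ : Q' = 0 ∧ P = 0 ∧ P' = Q := by omega
      obtain ⟨rfl, rfl, rfl⟩ := hQ
      have := g1 P' (by simp) (by simp) (by simp)
      subst this
      exact .inr (.inl ⟨by simp, by simp⟩)
  by_cases cP : P = 0 ∧ P' = 0
  · obtain ⟨rfl, rfl⟩ := cP
    simp only [mul_zero, zero_add] at heq g1 ⊢
    rcases hR with rfl | rfl
    · have hpos : 0 < f * R' := Nat.mul_pos h4 (by omega)
      have hQ' : Q' = 0 ∧ Q = f * R' := by
        rw [mul_zero] at heq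
        omega
      obtain ⟨rfl, rfl⟩ := hQ'
      have := g1 R' (by simp) (by simp) (by simp)
      subst this
      exact .inl (.inr (.inr ⟨by simp [mul_comm], by simp⟩))
    · have hpos : 0 < f * R := Nat.mul_pos h4 (by omega)
      have hQ' : Q = 0 ∧ Q' = f * R := by
        rw [mul_zero] at heq
        omega
      obtain ⟨rfl, rfl⟩ := hQ'
      have := g1 R (by simp) (by simp) (by simp)
      subst this
      exact .inr (.inr (.inr ⟨by simp [mul_comm], by simp⟩))
  by_cases cQ : Q = 0 ∧ Q' = 0
  · obtain ⟨rfl, rfl⟩ := cQ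
    simp only [mul_zero, add_zero] at heq g1 ⊢
    rcases hR with rfl | rfl
    · have hpos : 0 < f * R' := Nat.mul_pos h4 (by omega)
      have hQ' : P' = 0 ∧ P = f * R' := by
        rw [mul_zero] at heq
        omega
      obtain ⟨rfl, rfl⟩ := hQ'
      have := g1 R' (by simp) (by simp) (by simp)
      subst this
      exact .inl (.inr (.inl ⟨by simp [mul_comm], by simp⟩))
    · have hpos : 0 < f * R := Nat.mul_pos h4 (by omega)
      have hQ' : P = 0 ∧ P' = f * R := by
        rw [mul_zero] at heq
        omega
      obtain ⟨rfl, rfl⟩ := hQ'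
      have := g1 R (by simp) (by simp) (by simp)
      subst this
      exact .inr (.inr (.inl ⟨by simp [mul_comm], by simp⟩))
  · exfalso
    refine hno ⟨⟨fun _ => by omega, fun _ => by omega, by simp⟩, fun hcon => ?_⟩
    have := hcon.2.2 (by omega)
    simp at this

/-- Positivity of the generators excludes nonzero binomials in a single variable, so two-variable
supports are minimal; the coprimality conditions make the exponents relatively prime. -/
theorem binom_mem_circuits (h : IsArranged a σ d₁ d₂ d₃ f) {u v : Fin 3 →₀ ℕ}
    (hl : IsTwoVariablePair σ d₁ d₂ d₃ f u v) : binom K u v ∈ circuits K a := by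
  have hd := h.aDegree_eq_of_isTwoVariablePair hl
  have h1 := h.pos₁
  have h2 := h.pos₂
  have h3 := h.pos₃
  have h4 := h.pos_f
  have hf1 : 0 < f * d₁ := Nat.mul_pos h4 h1
  have hf2 : 0 < f * d₂ := Nat.mul_pos h4 h2
  have p0 := h.pos (σ 0)
  have p1 := h.pos (σ 1)
  have p2 := h.pos (σ 2)
  have hg : ∀ g x y, Nat.Coprime x y → g ∣ x → g ∣ y → g = 1 := fun g x y hxy hx hy =>
    Nat.eq_one_of_dvd_coprimes hxy hx hy
  have cop1 : Nat.Coprime (f * d₁) d₃ := h.coprime_f₃.mul_left h.coprime₁₃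
  have cop2 : Nat.Coprime (f * d₂) d₃ := h.coprime_f₃.mul_left h.coprime₂₃
  refine ⟨u, v, rfl, binom_mem_of_aDegree_eq hd, ?_, ?_, fun u' v' hne hd' => ?_⟩
  · rcases hl with ⟨rfl, rfl⟩ | ⟨rfl, rfl⟩ | ⟨rfl, rfl⟩ <;>
    · rw [expo_disjoint_support_iff]
      simp
  · rcases hl with ⟨rfl, rfl⟩ | ⟨rfl, rfl⟩ | ⟨rfl, rfl⟩ <;> rw [expo_add]
    · have := (dvd_univ_gcd_expo_iff (σ := σ)).1 (dvd_refl (Finset.univ.gcd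
        (⇑(expo σ (d₁ + 0) (0 + d₂) (0 + 0)))))
      exact hg _ _ _ h.coprime₁₂ this.1 (by simpa using this.2.1)
    · have := (dvd_univ_gcd_expo_iff (σ := σ)).1 (dvd_refl (Finset.univ.gcd
        (⇑(expo σ (f * d₁ + 0) (0 + 0) (0 + d₃)))))
      exact hg _ _ _ cop1 this.1 (by simpa using this.2.2)
    · have := (dvd_univ_gcd_expo_iff (σ := σ)).1 (dvd_refl (Finset.univ.gcd
        (⇑(expo σ (0 + 0) (f * d₂ + 0) (0 + d₃)))))
      exact hg _ _ _ cop2 this.2.1 (by simpa using this.2.2)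
  · rw [binom_mem_iff] at hd'
    obtain ⟨p, q, r, rfl⟩ := exists_eq_expo σ u'
    obtain ⟨p', q', r', rfl⟩ := exists_eq_expo σ v'
    have c0 : ¬ (q = 0 ∧ q' = 0 ∧ r = 0 ∧ r' = 0) := by
      rintro ⟨rfl, rfl, rfl, rfl⟩
      simp only [aDegree_expo, zero_mul, add_zero] at hd'
      exact hne (by rw [Nat.eq_of_mul_eq_mul_right p0 hd'])
    have c1 : ¬ (p = 0 ∧ p' = 0 ∧ r = 0 ∧ r' = 0) := by
      rintro ⟨rfl, rfl, rfl, rfl⟩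
      simp only [aDegree_expo, zero_mul, add_zero, zero_add] at hd'
      exact hne (by rw [Nat.eq_of_mul_eq_mul_right p1 hd'])
    have c2 : ¬ (p = 0 ∧ p' = 0 ∧ q = 0 ∧ q' = 0) := by
      rintro ⟨rfl, rfl, rfl, rfl⟩
      simp only [aDegree_expo, zero_mul, zero_add] at hd'
      exact hne (by rw [Nat.eq_of_mul_eq_mul_right p2 hd'])
    rcases hl with ⟨rfl, rfl⟩ | ⟨rfl, rfl⟩ | ⟨rfl, rfl⟩ <;>
    · rw [expo_support_union_ssubset_iff]
      omega

theorem upToSign_circuits (h : IsArranged a σ d₁ d₂ d₃ f) :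
    upToSign (circuits K a) = upToSign (binomSet K (IsTwoVariablePair σ d₁ d₂ d₃ f)) := by
  refine (upToSign_subset fun g hg => ?_).antisymm (Set.image_mono ?_)
  · obtain ⟨u, v, rfl, hmem, hdisj, hgcd, hmin⟩ := hg
    simp only [binom_mem_iff] at hmem hmin
    rcases h.isTwoVariablePair_of_isCircuit hmem hdisj hgcd hmin with hl | hl
    · exact .inl ⟨u, v, hl, rfl⟩
    · exact .inr ⟨v, u, hl, neg_binom _ _⟩
  · rintro _ ⟨u, v, hl, rfl⟩
    exact h.binom_mem_circuits hl

theorem ncard_upToSign_listed (h : IsArranged a σ d₁ d₂ d₃ f) :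
    (upToSign (binomSet K (IsListedPair σ d₁ d₂ d₃ f))).ncard = f + 2 := by
  have h1 := h.pos₁
  have h2 := h.pos₂
  have h3 := h.pos₃
  let g : ℕ → Set (MvPolynomial (Fin 3) K) := fun k =>
    {binom K (expo σ 0 0 d₃) (expo σ (k * d₁) ((f - k) * d₂) 0),
      -binom K (expo σ 0 0 d₃) (expo σ (k * d₁) ((f - k) * d₂) 0)}
  have hset : upToSign (binomSet K (IsListedPair σ d₁ d₂ d₃ f)) =
      insert {binom K (expo σ d₁ 0 0) (expo σ 0 d₂ 0), -binom K (expo σ d₁ 0 0) (expo σ 0 d₂ 0)}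
        (g '' (Finset.range (f + 1) : Finset ℕ)) := by
    ext s
    constructor
    · rintro ⟨_, ⟨u, v, ⟨rfl, rfl⟩ | ⟨k, l, hkl, rfl, rfl⟩, rfl⟩, rfl⟩
      · exact .inl rfl
      · refine .inr ⟨k, by simp; omega, ?_⟩
        simp only [g, show f - k = l by omega]
    · rintro (rfl | ⟨k, hk, rfl⟩)
      · exact ⟨_, ⟨_, _, .inl ⟨rfl, rfl⟩, rfl⟩, rfl⟩
      · rw [Finset.mem_coe, Finset.mem_range] at hk
        exact ⟨_, ⟨_, _, .inr ⟨k, f - k, by omega, rfl, rfl⟩, rfl⟩, rfl⟩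
  have hne : ∀ k, expo σ 0 0 d₃ ≠ expo σ (k * d₁) ((f - k) * d₂) 0 := by
    intro k
    rw [Ne, expo_inj]
    omega
  rw [hset, Set.ncard_insert_of_notMem _ ((Finset.finite_toSet _).image _), Set.InjOn.ncard_image,
    Set.ncard_coe_finset, Finset.card_range]
  -- The class up to sign determines the unordered exponent pair, and the exponent of x₁ recovers
  -- `k`.
  · intro k _ k' _ hkk
    rcases upToSign_pair_eq (hne k) hkk with ⟨-, he⟩ | ⟨he, -⟩
    · rw [expo_inj] at he
      exact (Nat.eq_of_mul_eq_mul_right h1 he.1).symm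
    · rw [expo_inj] at he
      omega
  · rintro ⟨k, -, hk⟩
    rcases upToSign_pair_eq (hne k) hk with ⟨he, -⟩ | ⟨he, he'⟩
    · rw [expo_inj] at he
      omega
    · rw [expo_inj] at he'
      omega

theorem ncard_upToSign_twoVariable (h : IsArranged a σ d₁ d₂ d₃ f) :
    (upToSign (binomSet K (IsTwoVariablePair σ d₁ d₂ d₃ f))).ncard = 3 := by
  have h1 := h.pos₁
  have h2 := h.pos₂
  have h3 := h.pos₃
  have hf1 : 0 < f * d₁ := Nat.mul_pos h.pos_f h1
  have hf2 : 0 < f * d₂ := Nat.mul_pos h.pos_f h2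
  rw [Set.ncard_eq_three]
  refine ⟨_, _, _, ?_, ?_, ?_, (?_ : _ = {
    {binom K (expo σ d₁ 0 0) (expo σ 0 d₂ 0), -binom K (expo σ d₁ 0 0) (expo σ 0 d₂ 0)},
    {binom K (expo σ (f * d₁) 0 0) (expo σ 0 0 d₃),
      -binom K (expo σ (f * d₁) 0 0) (expo σ 0 0 d₃)},
    {binom K (expo σ 0 (f * d₂) 0) (expo σ 0 0 d₃),
      -binom K (expo σ 0 (f * d₂) 0) (expo σ 0 0 d₃)}})⟩
  · intro he
    have := upToSign_pair_eq (by rw [Ne, expo_inj]; omega) he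
    simp only [expo_inj] at this
    omega
  · intro he
    have := upToSign_pair_eq (by rw [Ne, expo_inj]; omega) he
    simp only [expo_inj] at this
    omega
  · intro he
    have := upToSign_pair_eq (by rw [Ne, expo_inj]; omega) he
    simp only [expo_inj] at this
    omega
  · ext s
    constructor
    · rintro ⟨_, ⟨u, v, ⟨rfl, rfl⟩ | ⟨rfl, rfl⟩ | ⟨rfl, rfl⟩, rfl⟩, rfl⟩ <;> simp
    · rintro (rfl | rfl | rfl)
      · exact ⟨_, ⟨_, _, .inl ⟨rfl, rfl⟩, rfl⟩, rfl⟩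
      · exact ⟨_, ⟨_, _, .inr (.inl ⟨rfl, rfl⟩), rfl⟩, rfl⟩
      · exact ⟨_, ⟨_, _, .inr (.inr ⟨rfl, rfl⟩), rfl⟩, rfl⟩

end IsArranged

theorem binomSet_isListedPair (K : Type*) [Field K] (σ : Equiv.Perm (Fin 3)) (d₁ d₂ d₃ f : ℕ) :
    binomSet K (IsListedPair σ d₁ d₂ d₃ f) =
      insert (X (σ 0) ^ d₁ - X (σ 1) ^ d₂)
        {g | ∃ k l : ℕ, k + l = f ∧
          g = X (σ 2) ^ d₃ - X (σ 0) ^ (k * d₁) * X (σ 1) ^ (l * d₂)} := by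
  ext g
  constructor
  · rintro ⟨u, v, ⟨rfl, rfl⟩ | ⟨k, l, hkl, rfl, rfl⟩, rfl⟩
    · left
      simp [binom, monomial_expo]
    · exact .inr ⟨k, l, hkl, by simp [binom, monomial_expo]⟩
  · rintro (rfl | ⟨k, l, hkl, rfl⟩)
    · exact ⟨_, _, .inl ⟨rfl, rfl⟩, by simp [binom, monomial_expo]⟩
    · exact ⟨_, _, .inr ⟨k, l, hkl, rfl, rfl⟩, by simp [binom, monomial_expo]⟩

theorem binomSet_isTwoVariablePair (K : Type*) [Field K] (σ : Equiv.Perm (Fin 3))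
    (d₁ d₂ d₃ f : ℕ) :
    binomSet K (IsTwoVariablePair σ d₁ d₂ d₃ f) =
      {X (σ 0) ^ d₁ - X (σ 1) ^ d₂, X (σ 0) ^ (f * d₁) - X (σ 2) ^ d₃,
        X (σ 1) ^ (f * d₂) - X (σ 2) ^ d₃} := by
  ext g
  constructor
  · rintro ⟨u, v, ⟨rfl, rfl⟩ | ⟨rfl, rfl⟩ | ⟨rfl, rfl⟩, rfl⟩ <;> simp [binom, monomial_expo]
  · rintro (rfl | rfl | rfl)
    · exact ⟨_, _, .inl ⟨rfl, rfl⟩, by simp [binom, monomial_expo]⟩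
    · exact ⟨_, _, .inr (.inl ⟨rfl, rfl⟩), by simp [binom, monomial_expo]⟩
    · exact ⟨_, _, .inr (.inr ⟨rfl, rfl⟩), by simp [binom, monomial_expo]⟩

end Bases

/-! ### Arithmetic: from freeness or Betti divisibility to the normal form, and back. -/

section Arithmetic

variable {a : Fin 3 → ℕ}

theorem eq_one_of_dvd_of_gcd_eq_one (hg : Finset.univ.gcd a = 1) (σ : Equiv.Perm (Fin 3)) {g : ℕ}
    (h0 : g ∣ a (σ 0)) (h1 : g ∣ a (σ 1)) (h2 : g ∣ a (σ 2)) : g = 1 := by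
  rw [← Nat.dvd_one, ← hg]
  refine Finset.dvd_gcd fun t _ => ?_
  exact (forall_perm_fin_three (P := fun t => g ∣ a t) σ).2 ⟨h0, h1, h2⟩ t

/-- A common divisor of any of the four pairs of parameters would divide all three generators, whose
gcd is 1. -/
theorem IsMinimalGeneratingSystem.isArranged (ha : IsMinimalGeneratingSystem a)
    {σ : Equiv.Perm (Fin 3)} {d₁ d₂ d₃ f : ℕ} (e₁ : a (σ 0) = d₂ * d₃) (e₂ : a (σ 1) = d₁ * d₃)
    (e₃ : a (σ 2) = f * d₁ * d₂) : IsArranged a σ d₁ d₂ d₃ f := by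
  have p1 := ha.pos (σ 0)
  have p2 := ha.pos (σ 1)
  have p3 := ha.pos (σ 2)
  rw [e₁] at p1
  rw [e₂] at p2
  rw [e₃] at p3
  have hg : ∀ {x y : ℕ}, (Nat.gcd x y ∣ d₂ * d₃) → (Nat.gcd x y ∣ d₁ * d₃) →
      (Nat.gcd x y ∣ f * d₁ * d₂) → Nat.Coprime x y := fun h1 h2 h3 =>
    eq_one_of_dvd_of_gcd_eq_one ha.gcd_eq_one σ (e₁ ▸ h1) (e₂ ▸ h2) (e₃ ▸ h3)
  have l := fun x y => Nat.gcd_dvd_left x y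
  have r := fun x y => Nat.gcd_dvd_right x y
  refine ⟨Nat.pos_of_mul_pos_right p2, Nat.pos_of_mul_pos_right p1, Nat.pos_of_mul_pos_left p1,
    Nat.pos_of_mul_pos_right (Nat.pos_of_mul_pos_right p3), ?_, ?_, ?_, ?_, e₁, e₂, e₃⟩
  · exact hg (dvd_mul_of_dvd_left (r _ _) _) (dvd_mul_of_dvd_left (l _ _) _)
      (dvd_mul_of_dvd_right (r _ _) _)
  · exact hg (dvd_mul_of_dvd_right (r _ _) _) (dvd_mul_of_dvd_left (l _ _) _)
      (dvd_mul_of_dvd_left (dvd_mul_of_dvd_right (l _ _) _) _)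
  · exact hg (dvd_mul_of_dvd_left (l _ _) _) (dvd_mul_of_dvd_right (r _ _) _)
      (dvd_mul_of_dvd_right (l _ _) _)
  · exact hg (dvd_mul_of_dvd_right (r _ _) _) (dvd_mul_of_dvd_right (r _ _) _)
      (dvd_mul_of_dvd_left (dvd_mul_of_dvd_left (l _ _) _) _)

/-- The two gcds serve as d₁ and d₂; they are coprime, so their product divides the third generator.
The hypothesis makes the cofactor of d₂ in the first generator equal that of d₁ in the second, and
this cofactor is d₃. -/
theorem IsMinimalGeneratingSystem.exists_isArranged (ha : IsMinimalGeneratingSystem a)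
    (σ : Equiv.Perm (Fin 3))
    (h : Nat.gcd (a (σ 1)) (a (σ 2)) * a (σ 0) = Nat.gcd (a (σ 0)) (a (σ 2)) * a (σ 1)) :
    ∃ d₁ d₂ d₃ f, IsArranged a σ d₁ d₂ d₃ f := by
  set d₁ := Nat.gcd (a (σ 1)) (a (σ 2)) with hd₁
  set d₂ := Nat.gcd (a (σ 0)) (a (σ 2)) with hd₂
  have hcop : Nat.Coprime d₁ d₂ := by
    refine eq_one_of_dvd_of_gcd_eq_one ha.gcd_eq_one σ ?_ ?_ ?_
    · exact (Nat.gcd_dvd_right _ _).trans (Nat.gcd_dvd_left _ _)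
    · exact (Nat.gcd_dvd_left _ _).trans (Nat.gcd_dvd_left _ _)
    · exact (Nat.gcd_dvd_left _ _).trans (Nat.gcd_dvd_right _ _)
  have h2 : 0 < d₂ := Nat.gcd_pos_of_pos_left _ (ha.pos _)
  obtain ⟨s, hs⟩ : d₂ ∣ a (σ 0) := Nat.gcd_dvd_left _ _
  obtain ⟨f, hf⟩ : d₁ * d₂ ∣ a (σ 2) :=
    hcop.mul_dvd_of_dvd_of_dvd (Nat.gcd_dvd_right _ _) (Nat.gcd_dvd_right _ _)
  refine ⟨d₁, d₂, s, f, ha.isArranged hs ?_ (by rw [hf]; ring)⟩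
  rw [hs] at h
  refine Nat.eq_of_mul_eq_mul_left h2 ?_
  rw [← h]
  ring

theorem image_comp_ne (a : Fin 3 → ℕ) (σ : Equiv.Perm (Fin 3)) (i : Fin 3) :
    (a ∘ σ) '' {j | j ≠ i} = a '' {j | j ≠ σ i} := by
  rw [Set.image_comp]
  congr 1
  ext t
  constructor
  · rintro ⟨j, hj, rfl⟩
    exact fun h => hj (σ.injective h)
  · intro ht
    exact ⟨σ.symm t, fun h => ht (by rw [← h, Equiv.apply_symm_apply]), by simp⟩

theorem Ioi_zero_eq : (Set.Ioi 0 : Set (Fin 3)) = {j | j ≠ 0} := by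
  ext j
  exact Fin.pos_iff_ne_zero

theorem gcd_Ioi_zero (b : Fin 3 → ℕ) : (Finset.Ioi (0 : Fin 3)).gcd b = Nat.gcd (b 1) (b 2) := by
  rw [show (Finset.Ioi (0 : Fin 3)) = {1, 2} by decide, Finset.gcd_insert, Finset.gcd_singleton]
  simp [gcd_eq_nat_gcd]

theorem gcd_Ioi_one (b : Fin 3 → ℕ) : (Finset.Ioi (1 : Fin 3)).gcd b = b 2 := by
  rw [show (Finset.Ioi (1 : Fin 3)) = {2} by decide, Finset.gcd_singleton]
  simp

/-- The condition at the second position is automatic: that lcm is a multiple of the last generator.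
-/
theorem isUniversallyFree_iff : IsUniversallyFree a ↔ ∀ σ : Equiv.Perm (Fin 3),
    Nat.lcm (a (σ 0)) (Nat.gcd (a (σ 1)) (a (σ 2))) ∈
      AddSubmonoid.closure (a '' {j | j ≠ σ 0}) := by
  refine forall_congr' fun σ => ⟨fun h => ?_, fun h i hi => ?_⟩
  · have := h 0 (by simp)
    rwa [gcd_Ioi_zero, Ioi_zero_eq, image_comp_ne] at this
  · fin_cases i
    · change Nat.lcm ((a ∘ σ) 0) ((Finset.Ioi (0 : Fin 3)).gcd (a ∘ σ)) ∈
        AddSubmonoid.closure ((a ∘ σ) '' Set.Ioi 0)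
      rwa [gcd_Ioi_zero, Ioi_zero_eq, image_comp_ne]
    · change Nat.lcm ((a ∘ σ) 1) ((Finset.Ioi (1 : Fin 3)).gcd (a ∘ σ)) ∈
        AddSubmonoid.closure ((a ∘ σ) '' Set.Ioi 1)
      rw [gcd_Ioi_one]
      have hmem : (a ∘ σ) 2 ∈ AddSubmonoid.closure ((a ∘ σ) '' Set.Ioi 1) :=
        AddSubmonoid.subset_closure (Set.mem_image_of_mem (a ∘ σ) (Set.mem_Ioi.2 (by decide)))
      obtain ⟨c, hc⟩ := Nat.dvd_lcm_right ((a ∘ σ) 1) ((a ∘ σ) 2)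
      rw [hc, mul_comm, ← smul_eq_mul]
      exact AddSubmonoid.nsmul_mem _ hmem c
    · simp at hi

/-- By coprimality the lcm is a product q·a₁ + r·a₂ (indices along `σ`). As gcd(a₀, a₂) divides the
product and a₂ but is coprime to a₁, it divides q; symmetrically gcd(a₀, a₁) divides r. -/
theorem IsUniversallyFree.exists_eq (ha : IsMinimalGeneratingSystem a) (h : IsUniversallyFree a)
    (σ : Equiv.Perm (Fin 3)) : ∃ x y,
      Nat.gcd (a (σ 1)) (a (σ 2)) * a (σ 0) =
        x * (Nat.gcd (a (σ 0)) (a (σ 2)) * a (σ 1)) +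
          y * (Nat.gcd (a (σ 0)) (a (σ 1)) * a (σ 2)) := by
  have hmem := isUniversallyFree_iff.1 h σ
  have hcop : Nat.Coprime (a (σ 0)) (Nat.gcd (a (σ 1)) (a (σ 2))) := by
    refine eq_one_of_dvd_of_gcd_eq_one ha.gcd_eq_one σ (Nat.gcd_dvd_left _ _) ?_ ?_
    · exact (Nat.gcd_dvd_right _ _).trans (Nat.gcd_dvd_left _ _)
    · exact (Nat.gcd_dvd_right _ _).trans (Nat.gcd_dvd_right _ _)
  rw [hcop.lcm_eq_mul] at hmem
  obtain ⟨u, hu, hd⟩ := mem_closure_image_iff.1 hmem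
  obtain ⟨p, q, r, rfl⟩ := exists_eq_expo σ u
  have hp : p = 0 := by simpa using hu (σ 0) (by simp)
  subst hp
  rw [aDegree_expo, zero_mul, zero_add, mul_comm] at hd
  have d02 : Nat.Coprime (Nat.gcd (a (σ 0)) (a (σ 2))) (a (σ 1)) :=
    eq_one_of_dvd_of_gcd_eq_one ha.gcd_eq_one σ ((Nat.gcd_dvd_left _ _).trans (Nat.gcd_dvd_left _ _))
      (Nat.gcd_dvd_right _ _) ((Nat.gcd_dvd_left _ _).trans (Nat.gcd_dvd_right _ _))
  have d01 : Nat.Coprime (Nat.gcd (a (σ 0)) (a (σ 1))) (a (σ 2)) :=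
    eq_one_of_dvd_of_gcd_eq_one ha.gcd_eq_one σ ((Nat.gcd_dvd_left _ _).trans (Nat.gcd_dvd_left _ _))
      ((Nat.gcd_dvd_left _ _).trans (Nat.gcd_dvd_right _ _)) (Nat.gcd_dvd_right _ _)
  obtain ⟨x, rfl⟩ : Nat.gcd (a (σ 0)) (a (σ 2)) ∣ q := by
    refine d02.dvd_of_dvd_mul_right ?_
    refine (Nat.dvd_add_left (dvd_mul_of_dvd_right (Nat.gcd_dvd_right (a (σ 0)) (a (σ 2))) r)).1 ?_
    rw [← hd]
    exact dvd_mul_of_dvd_right (Nat.gcd_dvd_left _ _) _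
  obtain ⟨y, rfl⟩ : Nat.gcd (a (σ 0)) (a (σ 1)) ∣ r := by
    refine d01.dvd_of_dvd_mul_right ?_
    refine (Nat.dvd_add_right (dvd_mul_of_dvd_right (Nat.gcd_dvd_right (a (σ 0)) (a (σ 1)))
      (Nat.gcd (a (σ 0)) (a (σ 2)) * x))).1 ?_
    rw [← hd]
    exact dvd_mul_of_dvd_right (Nat.gcd_dvd_left _ _) _
  exact ⟨x, y, by rw [hd]; ring⟩

theorem exists_perm_monotone (b : Fin 3 → ℕ) :
    ∃ σ : Equiv.Perm (Fin 3), b (σ 0) ≤ b (σ 1) ∧ b (σ 1) ≤ b (σ 2) :=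
  ⟨Tuple.sort b, Tuple.monotone_sort b (by decide), Tuple.monotone_sort b (by decide)⟩

/-- Sort the three products `b`. The smallest is a positive combination of the others, hence at
least one of them, so it equals the middle one. -/
theorem IsUniversallyFree.exists_isArranged (ha : IsMinimalGeneratingSystem a)
    (h : IsUniversallyFree a) : ∃ σ d₁ d₂ d₃ f, IsArranged a σ d₁ d₂ d₃ f := by
  let b : Fin 3 → ℕ := fun i => (Finset.univ.erase i).gcd a * a i
  have hb : ∀ (σ : Equiv.Perm (Fin 3)) (i j k : Fin 3), ({j, k} : Finset (Fin 3)) =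
      Finset.univ.erase i → b (σ i) = Nat.gcd (a (σ j)) (a (σ k)) * a (σ i) := by
    intro σ i j k hijk
    have : Finset.univ.erase (σ i) = {σ j, σ k} := by
      have := congrArg (Finset.map σ.toEmbedding) hijk
      rw [Finset.map_erase, Finset.map_univ_equiv] at this
      simpa using this.symm
    simp only [b, this]
    rw [Finset.gcd_insert, Finset.gcd_singleton]
    simp [gcd_eq_nat_gcd]
  obtain ⟨σ, h01, h12⟩ := exists_perm_monotone b
  obtain ⟨x, y, hxy⟩ := h.exists_eq ha σ
  have b0 := hb σ 0 1 2 (by decide)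
  have b1 := hb σ 1 0 2 (by decide)
  have b2 := hb σ 2 0 1 (by decide)
  refine ⟨σ, ha.exists_isArranged σ ?_⟩
  rw [← b0, ← b1, ← b2] at hxy
  rw [← b0, ← b1]
  refine le_antisymm h01 ?_
  have hpos : 0 < b (σ 0) := by
    rw [b0]
    exact Nat.mul_pos (Nat.gcd_pos_of_pos_left _ (ha.pos _)) (ha.pos _)
  rcases Nat.eq_zero_or_pos x with rfl | hx
  · rcases Nat.eq_zero_or_pos y with rfl | hy
    · omega
    · have := Nat.le_mul_of_pos_left (b (σ 2)) hy
      omega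
  · have := Nat.le_mul_of_pos_left (b (σ 1)) hx
    omega

/-- The lcm is a positive multiple of `a i` lying in ⟨`a j`⟩. -/
theorem IsCritical.le_lcm {n : ℕ} {a : Fin n → ℕ} (ha : ∀ i, 0 < a i) {i j : Fin n} (hij : j ≠ i)
    {c : ℕ} (hc : IsCritical a i c) : c * a i ≤ Nat.lcm (a i) (a j) := by
  obtain ⟨x, hx⟩ := Nat.dvd_lcm_left (a i) (a j)
  obtain ⟨y, hy⟩ := Nat.dvd_lcm_right (a i) (a j)
  have hpos : 0 < Nat.lcm (a i) (a j) := Nat.lcm_pos (ha i) (ha j)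
  have hx0 : 0 < x := Nat.pos_of_ne_zero (by rintro rfl; omega)
  have : c ≤ x := by
    refine hc.2 (show 0 < x ∧ _ from ⟨hx0, ?_⟩)
    rw [mul_comm, ← hx, hy, mul_comm]
    exact AddSubmonoid.nsmul_mem _ (AddSubmonoid.subset_closure (Set.mem_image_of_mem a hij)) _
  rw [hx, mul_comm]
  gcongr

theorem IsBettiDivisible.exists_isArranged {K : Type*} [Field K]
    (ha : IsMinimalGeneratingSystem a) (h : IsBettiDivisible K a) :
    ∃ σ d₁ d₂ d₃ f, IsArranged a σ d₁ d₂ d₃ f := by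
  have hex : ∀ i, ∃ c, IsCritical a i c := fun i =>
    exists_isCritical ha.pos (j := i + 1) (by fin_cases i <;> decide)
  choose c hc using hex
  let b : Fin 3 → ℕ := fun i => c i * a i
  have hbpos : ∀ i, 0 < b i := fun i => Nat.mul_pos (hc i).1.1 (ha.pos i)
  have hdvd : ∀ i j, b i ≤ b j → b i ∣ b j := by
    intro i j hij
    rcases h _ ((hc i).mem_bettiDegrees K ha.pos) _ ((hc j).mem_bettiDegrees K ha.pos) with h1 | h1
    · exact h1
    · exact dvd_of_eq (hij.antisymm (Nat.le_of_dvd (hbpos i) h1))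
  have hlcm : ∀ i j l, j ≠ i → a j ∣ b l → a i ∣ b l → c l * a l ≤ Nat.lcm (a i) (a j) →
      b l = Nat.lcm (a i) (a j) := by
    intro i j l hij hj hi hle
    exact hle.antisymm (Nat.le_of_dvd (hbpos l) (Nat.lcm_dvd hi hj))
  have hab : ∀ i, a i ∣ b i := fun i => dvd_mul_left _ _
  obtain ⟨σ, h01, h12⟩ := exists_perm_monotone b
  refine ⟨σ, ha.exists_isArranged σ ?_⟩
  -- By divisibility every generator divides the largest critical degree, which is therefore at
  -- least these lcms; `IsCritical.le_lcm` gives the reverse bound.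
  have e1 : b (σ 2) = Nat.lcm (a (σ 2)) (a (σ 0)) :=
    hlcm _ _ _ (by simp) ((hab _).trans (hdvd _ _ (h01.trans h12))) (hab _)
      ((hc _).le_lcm ha.pos (by simp))
  have e2 : b (σ 2) = Nat.lcm (a (σ 2)) (a (σ 1)) :=
    hlcm _ _ _ (by simp) ((hab _).trans (hdvd _ _ h12)) (hab _) ((hc _).le_lcm ha.pos (by simp))
  have g0 := Nat.gcd_mul_lcm (a (σ 2)) (a (σ 0))
  have g1 := Nat.gcd_mul_lcm (a (σ 2)) (a (σ 1))
  rw [← e1, Nat.gcd_comm] at g0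
  rw [← e2, Nat.gcd_comm] at g1
  refine Nat.eq_of_mul_eq_mul_left (Nat.mul_pos (ha.pos (σ 2)) (hbpos (σ 2))) ?_
  calc a (σ 2) * b (σ 2) * (Nat.gcd (a (σ 1)) (a (σ 2)) * a (σ 0))
      = (Nat.gcd (a (σ 1)) (a (σ 2)) * b (σ 2)) * (a (σ 2) * a (σ 0)) := by ring
    _ = (a (σ 2) * a (σ 1)) * (Nat.gcd (a (σ 0)) (a (σ 2)) * b (σ 2)) := by rw [g1, g0]
    _ = _ := by ring

theorem IsArranged.isUniversallyFree {σ : Equiv.Perm (Fin 3)} {d₁ d₂ d₃ f : ℕ}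
    (h : IsArranged a σ d₁ d₂ d₃ f) : IsUniversallyFree a := by
  rw [isUniversallyFree_iff]
  -- By coprimality the lcm is a multiple of `a i * d`, which is a multiple of `a j`.
  have key : ∀ i j, i ≠ j → ∀ d x N, Nat.Coprime (a i) d → d * a i = x * a j → d ∣ N →
      Nat.lcm (a i) N ∈ AddSubmonoid.closure (a '' {j | j ≠ i}) := by
    intro i j hij d x N hcop he hN
    obtain ⟨c, hc⟩ : a i * d ∣ Nat.lcm (a i) N :=
      hcop.mul_dvd_of_dvd_of_dvd (Nat.dvd_lcm_left _ _) (hN.trans (Nat.dvd_lcm_right _ _))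
    rw [hc, mul_comm (a i), he, mul_comm, ← mul_assoc]
    exact AddSubmonoid.nsmul_mem _ (AddSubmonoid.subset_closure
      (Set.mem_image_of_mem a hij.symm)) _
  -- Describing the gcd only by its common divisors makes one statement serve both orders of the
  -- remaining two generators.
  have hall : ∀ i, ∀ N, (∀ d, (∀ j, j ≠ i → d ∣ a j) → d ∣ N) →
      Nat.lcm (a i) N ∈ AddSubmonoid.closure (a '' {j | j ≠ i}) := by
    rw [forall_perm_fin_three σ]
    refine ⟨fun N hN => key _ (σ 1) (by simp) d₁ d₂ N ?_ ?_ (hN d₁ ?_),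
      fun N hN => key _ (σ 0) (by simp) d₂ d₁ N ?_ ?_ (hN d₂ ?_),
      fun N hN => key _ (σ 0) (by simp) d₃ (f * d₁) N ?_ ?_ (hN d₃ ?_)⟩
    · rw [h.eq₁]
      exact h.coprime₁₂.symm.mul_left h.coprime₁₃.symm
    · rw [h.eq₁, h.eq₂]
      ring
    · rw [forall_perm_fin_three σ, h.eq₂, h.eq₃]
      exact ⟨fun h => absurd rfl h, fun _ => ⟨d₃, rfl⟩, fun _ => ⟨f * d₂, by ring⟩⟩
    · rw [h.eq₂]
      exact h.coprime₁₂.mul_left h.coprime₂₃.symm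
    · rw [h.eq₁, h.eq₂]
      ring
    · rw [forall_perm_fin_three σ, h.eq₁, h.eq₃]
      exact ⟨fun _ => ⟨d₃, rfl⟩, fun h => absurd rfl h, fun _ => ⟨f * d₁, by ring⟩⟩
    · rw [h.eq₃]
      exact (h.coprime_f₃.mul_left h.coprime₁₃).mul_left h.coprime₂₃
    · rw [h.eq₁, h.eq₃]
      ring
    · rw [forall_perm_fin_three σ, h.eq₁, h.eq₂]
      exact ⟨fun _ => ⟨d₂, by ring⟩, fun _ => ⟨d₁, by ring⟩, fun h => absurd rfl h⟩
  exact fun τ => hall (τ 0) _ fun d hd => Nat.dvd_gcd (hd _ (by simp)) (hd _ (by simp))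

theorem exists_perm_of_range_eq (ha : Function.Injective a) {x y z : ℕ}
    (h : Set.range a = {x, y, z}) :
    ∃ σ : Equiv.Perm (Fin 3), a (σ 0) = x ∧ a (σ 1) = y ∧ a (σ 2) = z := by
  obtain ⟨i, hi⟩ : x ∈ Set.range a := h ▸ by simp
  obtain ⟨j, hj⟩ : y ∈ Set.range a := h ▸ by simp
  obtain ⟨k, hk⟩ : z ∈ Set.range a := h ▸ by simp
  have hsurj : Function.Surjective ![i, j, k] := by
    intro t
    have ht : a t ∈ ({x, y, z} : Set ℕ) := h ▸ ⟨t, rfl⟩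
    rcases ht with ht | ht | ht
    · exact ⟨0, ha (by simp [hi, ht])⟩
    · exact ⟨1, ha (by simp [hj, ht])⟩
    · exact ⟨2, ha (by simp only [Set.mem_singleton_iff] at ht; simp [hk, ht])⟩
  exact ⟨Equiv.ofBijective _ (Finite.surjective_iff_bijective.1 hsurj), by simpa, by simpa,
    by simpa⟩

theorem IsArranged.range_eq {σ : Equiv.Perm (Fin 3)} {d₁ d₂ d₃ f : ℕ}
    (h : IsArranged a σ d₁ d₂ d₃ f) : Set.range a = {d₂ * d₃, d₁ * d₃, f * d₁ * d₂} := by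
  rw [← h.eq₁, ← h.eq₂, ← h.eq₃]
  ext t
  constructor
  · rintro ⟨i, rfl⟩
    revert i
    rw [forall_perm_fin_three σ]
    simp
  · rintro (rfl | rfl | rfl) <;> exact ⟨_, rfl⟩

end Arithmetic

end ToricBases

theorem theorem4p1 (K : Type*) [Field K] (a : Fin 3 → ℕ)
    (ha : ToricBases.IsMinimalGeneratingSystem a) :
    List.TFAE [
      ToricBases.IsUniversallyFree a,
      ToricBases.IsBettiDivisible K a,
      ∃ d₁ d₂ d₃ f₃ : ℕ, 0 < d₁ ∧ 0 < d₂ ∧ 0 < d₃ ∧ 0 < f₃ ∧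
        Set.range a = {d₂ * d₃, d₁ * d₃, f₃ * d₁ * d₂} ∧
        ToricBases.bettiDegrees K a = {d₁ * d₂ * d₃, f₃ * d₁ * d₂ * d₃}] ∧
    ∀ d₁ d₂ d₃ f₃ : ℕ, 0 < d₁ → 0 < d₂ → 0 < d₃ → 0 < f₃ →
      Set.range a = {d₂ * d₃, d₁ * d₃, f₃ * d₁ * d₂} →
      ToricBases.bettiDegrees K a = {d₁ * d₂ * d₃, f₃ * d₁ * d₂ * d₃} →
      (Nat.Coprime d₁ d₂ ∧ Nat.Coprime d₁ d₃ ∧ Nat.Coprime d₂ d₃ ∧ Nat.Coprime f₃ d₃) ∧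
      -- the indeterminates can be permuted so that the generators come in the displayed order
      (∃ σ : Equiv.Perm (Fin 3),
        a (σ 0) = d₂ * d₃ ∧ a (σ 1) = d₁ * d₃ ∧ a (σ 2) = f₃ * d₁ * d₂) ∧
      ∀ σ : Equiv.Perm (Fin 3),
        a (σ 0) = d₂ * d₃ → a (σ 1) = d₁ * d₃ → a (σ 2) = f₃ * d₁ * d₂ →
        ∀ (x₁ x₂ x₃ : MvPolynomial (Fin 3) K), x₁ = MvPolynomial.X (σ 0) →
          x₂ = MvPolynomial.X (σ 1) → x₃ = MvPolynomial.X (σ 2) →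
          (ToricBases.upToSign (ToricBases.universalMarkovBasis K a) =
              ToricBases.upToSign (insert (x₁ ^ d₁ - x₂ ^ d₂)
                {g | ∃ k l : ℕ, k + l = f₃ ∧
                  g = x₃ ^ d₃ - x₁ ^ (k * d₁) * x₂ ^ (l * d₂)}) ∧
            ToricBases.upToSign (ToricBases.universalMarkovBasis K a) =
              ToricBases.upToSign (ToricBases.criticalBinomials K a) ∧
            ToricBases.upToSign (ToricBases.universalMarkovBasis K a) =
              ToricBases.upToSign (ToricBases.graverBasis K a) ∧
            (ToricBases.upToSign (ToricBases.universalMarkovBasis K a)).ncard = f₃ + 2) ∧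
          ToricBases.upToSign (ToricBases.universalGroebnerBasis K a) =
            ToricBases.upToSign {x₁ ^ d₁ - x₂ ^ d₂, x₁ ^ (f₃ * d₁) - x₃ ^ d₃,
              x₂ ^ (f₃ * d₂) - x₃ ^ d₃} ∧
          ToricBases.upToSign (ToricBases.universalGroebnerBasis K a) =
            ToricBases.upToSign (ToricBases.circuits K a) ∧
          (ToricBases.upToSign (ToricBases.universalGroebnerBasis K a)).ncard = 3 := by
  
  classical
  refine ⟨?_, fun d₁ d₂ d₃ f₃ _ _ _ _ hA _ => ?_⟩
  · tfae_have 1 → 3 := by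
      intro h
      obtain ⟨σ, d₁, d₂, d₃, f, h⟩ := h.exists_isArranged ha
      exact ⟨d₁, d₂, d₃, f, h.pos₁, h.pos₂, h.pos₃, h.pos_f, h.range_eq, h.bettiDegrees_eq⟩
    tfae_have 2 → 3 := by
      intro h
      obtain ⟨σ, d₁, d₂, d₃, f, h⟩ := h.exists_isArranged ha
      exact ⟨d₁, d₂, d₃, f, h.pos₁, h.pos₂, h.pos₃, h.pos_f, h.range_eq, h.bettiDegrees_eq⟩
    tfae_have 3 → 1 := by
      rintro ⟨d₁, d₂, d₃, f, -, -, -, -, hA, -⟩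
      obtain ⟨σ, e₁, e₂, e₃⟩ := ToricBases.exists_perm_of_range_eq ha.injective hA
      exact (ha.isArranged e₁ e₂ e₃).isUniversallyFree
    tfae_have 3 → 2 := by
      rintro ⟨d₁, d₂, d₃, f, -, -, -, -, -, hB⟩ b hb b' hb'
      rw [hB] at hb hb'
      have hd : d₁ * d₂ * d₃ ∣ f * d₁ * d₂ * d₃ := ⟨f, by ring⟩
      rcases hb with rfl | rfl <;> rcases hb' with rfl | rfl
      · exact .inl dvd_rfl
      · exact .inl hd
      · exact .inr hd
      · exact .inl dvd_rfl
    tfae_finish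
  · obtain ⟨σ, e₁, e₂, e₃⟩ := ToricBases.exists_perm_of_range_eq ha.injective hA
    have h := ha.isArranged e₁ e₂ e₃
    refine ⟨⟨h.coprime₁₂, h.coprime₁₃, h.coprime₂₃, h.coprime_f₃⟩, ⟨σ, e₁, e₂, e₃⟩, ?_⟩
    -- Any permutation giving the displayed order yields its own normal form, which need not be the
    -- one found above when, for instance, f₃ = 1.
    rintro τ t₁ t₂ t₃ _ _ _ rfl rfl rfl
    have h := ha.isArranged t₁ t₂ t₃
    rw [← ToricBases.binomSet_isListedPair, ← ToricBases.binomSet_isTwoVariablePair,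
      h.upToSign_universalMarkovBasis, h.upToSign_criticalBinomials, h.upToSign_graverBasis,
      h.upToSign_universalGroebnerBasis, h.upToSign_circuits]
    exact ⟨⟨rfl, rfl, rfl, h.ncard_upToSign_listed⟩, rfl, rfl, h.ncard_upToSign_twoVariable⟩
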